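/- Let $\mathbb K=\mathbb R$ or $\mathbb C$, let $V$ be an open neighbourhood of $0$ in $\mathbb K^n$, and let $|\cdot|$ be the Euclidean norm. Call an analytic function $f$ on an open set $U\subset\mathbb K^n$ algebraic (or Nash) if there is a nonzero polynomial $P\in\mathbb K[x_1,\dots,x_n,t]$ with $P(x,f(x))=0$ for all $x\in U$; a map is algebraic (respectively, analytic) if all its components are. By a closed algebraic (respectively, analytic) subset of $U$ we mean the set of common zeros in $U$ of finitely many algebraic (respectively, analytic) functions on $U$. A power series $\sum_{\alpha}F_\alpha (x-a)^\alpha$ is said to converge in a ball $|x-a|<r$ if it converges absolutely at each point $x\in\mathbb K^n$ of that ball, and its radius of convergence is the supremum in $[0,\infty]$ of the radii of the balls centred at $a$ in which it converges. Theorem 1.4. Let $\varphi: V\to\mathbb K^n$ be an algebraic (respectively, analytic) map whose Jacobian determinant $\Delta=\det(\partial\varphi_i/\partial x_j)$ does not vanish identically in a neighbourhood of $0$. Then there are an open ball $W\subset V$ centred at $0$, constants $\delta>0$ and $\lambda\in\mathbb N$, and a finite filtration by closed algebraic (respectively, analytic) subsets of $W$, $$W=X_0\supset X_1\supset\cdots\supset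 X_{k+1}=\emptyset,$$ such that for each $j=0,\dots,k$ there is a multi-index $\alpha=\alpha(j)\in\mathbb N^n$ with the following properties for every $a\in X_j\setminus X_{j+1}$: (1) $D^\alpha\Delta(a)\neq 0$, where $D^\alpha=\partial^{|\alpha|}/\partial x_1^{\alpha_1}\cdots\partial x_n^{\alpha_n}$. (2) If $G$ is a formal power series centred at $\varphi(a)$, $0<r\le 1$, and the formal composition $G\circ\widehat\varphi_a$ of $G$ with the Taylor expansion $\widehat\varphi_a$ of $\varphi$ at $a$ converges in the ball $|x-a|<r$, then the radius of convergence $r_G$ of $G$ satisfies $$r_G\ \ge\ \delta\,|D^\alpha\Delta(a)|^2\,r^\lambda .$$ -/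

import Mathlib

open Set Filter Topology
open scoped ENNReal NNReal

namespace RadiusControl

variable {𝕂 : Type*} [RCLike 𝕂] {n : ℕ}

/-- The first partial derivative `∂f/∂xᵢ` of a function on `𝕂ⁿ`. -/
noncomputable def pderiv (i : Fin n) (f : EuclideanSpace 𝕂 (Fin n) → 𝕂) :
    EuclideanSpace 𝕂 (Fin n) → 𝕂 :=
  fun x => fderiv 𝕂 f x (EuclideanSpace.single i 1)

/-- The iterated partial derivative `D^α = ∂^{|α|} / ∂x₁^{α₁} ⋯ ∂xₙ^{αₙ}`. -/
noncomputable def multiDeriv (α : Fin n →₀ ℕ) (f : EuclideanSpace 𝕂 (Fin n) → 𝕂) :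
    EuclideanSpace 𝕂 (Fin n) → 𝕂 :=
  (List.finRange n).foldr (fun i g => (pderiv i)^[α i] g) f

/-- The Jacobian determinant `det (∂φᵢ/∂xⱼ)` of a map `𝕂ⁿ → 𝕂ⁿ`. -/
noncomputable def jacobianDet (φ : EuclideanSpace 𝕂 (Fin n) → EuclideanSpace 𝕂 (Fin n)) :
    EuclideanSpace 𝕂 (Fin n) → 𝕂 :=
  fun x => Matrix.det (Matrix.of fun i j : Fin n => pderiv j (fun y => φ y i) x)

/-- The Taylor series of `f` at `a`, in the variables `x - a`: its coefficients
are `D^α f(a) / α!`. -/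
noncomputable def taylorSeries (f : EuclideanSpace 𝕂 (Fin n) → 𝕂)
    (a : EuclideanSpace 𝕂 (Fin n)) : MvPowerSeries (Fin n) 𝕂 :=
  fun α => multiDeriv α f a / ((∏ i, (α i).factorial : ℕ) : 𝕂)

/-- The Taylor expansion of `φ - φ(a)` at `a`, component by component. -/
noncomputable def taylorIncrement (φ : EuclideanSpace 𝕂 (Fin n) → EuclideanSpace 𝕂 (Fin n))
    (a : EuclideanSpace 𝕂 (Fin n)) (i : Fin n) : MvPowerSeries (Fin n) 𝕂 :=
  taylorSeries (fun x => φ x i) a - MvPowerSeries.C (φ a i)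

/-- The increments have no constant term, so they can be substituted in any formal power series. -/
theorem hasSubst_taylorIncrement
    (φ : EuclideanSpace 𝕂 (Fin n) → EuclideanSpace 𝕂 (Fin n)) (a : EuclideanSpace 𝕂 (Fin n)) :
    MvPowerSeries.HasSubst (taylorIncrement φ a) := by
  apply MvPowerSeries.hasSubst_of_constantCoeff_zero
  intro i
  have h0 : multiDeriv (0 : Fin n →₀ ℕ) (fun x => φ x i) a = φ a i := by
    unfold multiDeriv
    induction List.finRange n with
    | nil => rfl
    | cons b l _ => simp
  have h1 : MvPowerSeries.constantCoeff (taylorSeries (fun x => φ x i) a) = φ a i := by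
    rw [← MvPowerSeries.coeff_zero_eq_constantCoeff_apply]
    change multiDeriv (0 : Fin n →₀ ℕ) (fun x => φ x i) a / _ = _
    rw [h0]
    simp
  simp [taylorIncrement, h1]

/-- The formal composition `G ∘ φ̂ₐ`, for a formal power series `G` centred at `φ(a)` (given by its
coefficients, that is, as a series in the variables `y - φ(a)`) and the Taylor expansion `φ̂ₐ`
of `φ` at `a`. The result is a series in the variables `x - a`. -/
noncomputable def formalComp (G : MvPowerSeries (Fin n) 𝕂)
    (φ : EuclideanSpace 𝕂 (Fin n) → EuclideanSpace 𝕂 (Fin n)) (a : EuclideanSpace 𝕂 (Fin n)) :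
    MvPowerSeries (Fin n) 𝕂 :=
  MvPowerSeries.subst (taylorIncrement φ a) G

/-- The power series `∑ F_α v^α` (with `v = x - a` for a series centred at `a`) converges in the
open Euclidean ball `|v| < r`. A multi-indexed series has no preferred order of summation;
convergence is unconditional, which for scalar series is absolute convergence. -/
def ConvergesOnBall (F : MvPowerSeries (Fin n) 𝕂) (r : ℝ) : Prop :=
  ∀ v : EuclideanSpace 𝕂 (Fin n), ‖v‖ < r →
    Summable fun α : Fin n →₀ ℕ => MvPowerSeries.coeff α F * ∏ i, v i ^ α i

/-- The radius of convergence, in `[0, ∞]`: the supremum of the radii of the balls in which the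
series converges. -/
noncomputable def convergenceRadius (G : MvPowerSeries (Fin n) 𝕂) : ℝ≥0∞ :=
  ⨆ (ρ : ℝ≥0) (_ : ConvergesOnBall G ρ), (ρ : ℝ≥0∞)

/-- A Nash (or algebraic) function on an open set `U ⊆ 𝕂ⁿ`: an analytic function satisfying a
nontrivial polynomial equation `P(x, f(x)) = 0` on `U`. -/
def IsNashOn (U : Set (EuclideanSpace 𝕂 (Fin n))) (f : EuclideanSpace 𝕂 (Fin n) → 𝕂) : Prop :=
  AnalyticOnNhd 𝕂 f U ∧
    ∃ P : Polynomial (MvPolynomial (Fin n) 𝕂), P ≠ 0 ∧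
      ∀ x ∈ U, (P.map (MvPolynomial.eval fun i => x i)).eval (f x) = 0

/-- The two parallel settings: algebraic (Nash) and analytic. -/
inductive FunctionClass
  | algebraic
  | analytic

/-- `f` is a function of the given class on the open set `U`. -/
def FunctionClass.IsOn (c : FunctionClass) (U : Set (EuclideanSpace 𝕂 (Fin n)))
    (f : EuclideanSpace 𝕂 (Fin n) → 𝕂) : Prop :=
  match c with
  | .algebraic => IsNashOn U f
  | .analytic => AnalyticOnNhd 𝕂 f U

/-- `X` is a closed algebraic (respectively, analytic) subset of the open set `W`: the set of
common zeros in `W` of finitely many algebraic (respectively, analytic) functions on `W`. -/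
def FunctionClass.IsClosedSubset (c : FunctionClass) (W X : Set (EuclideanSpace 𝕂 (Fin n))) :
    Prop :=
  ∃ (m : ℕ) (f : Fin m → EuclideanSpace 𝕂 (Fin n) → 𝕂),
    (∀ i, c.IsOn W (f i)) ∧ X = {x ∈ W | ∀ i, f i x = 0}

end RadiusControl

/-! By the chain rule and Cramer's rule, `Δ · (∂ᵢG ∘ φ)` is a combination of the first derivatives
of `G ∘ φ`, with cofactors of the Jacobian matrix as coefficients. Iterating, with `m = |β|`, the
series `Δ^(2m) · (∂^β G ∘ φ)` is reached from `G ∘ φ` in `m` steps, each with one order of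
differentiation and no division (`det_pow_mul_subst_pderiv`). In the weighted norms `∑ |F_γ| s^|γ|`,
Cauchy's estimate charges each step a factor `1/h` and a loss `h` of radius. With `h = s/m` the
steps lead from radius `2s` to `s` at the price `(const/s)^m · m^m` (`wnorm_numerator_le`), and `m^m
≤ (3n)^m β!`.

Dividing by `Δ`, which may vanish at `a`, is avoided by reading off a single coefficient. If `α` is
the initial exponent of `Δ` at `a` in the graded lexicographic order, with coefficient `Δ_α`, then
the coefficient of `Δ^(2m) · (∂^β G ∘ φ)` at `2mα` is `Δ_α^(2m) · β! · G_β`. The factorials cancel,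
and `|G_β|` grows at most like the `m`-th power of `const / (|Δ_α|² s^(2|α|+1))`
(`enorm_coeff_mul_pow_le`); this explains the square and the exponent `λ`. Taking `s` proportional
to `r` gives the bound. Its constants are uniform in `a`, since the Taylor series of an analytic
function at nearby points are uniformly bounded in norm (`exists_wnorm_taylorSeries_le`).

For the filtration, `X_j` is the locus where the first `j` derivatives `D^γ Δ`, in graded
lexicographic order, vanish; on `X_j \ X_(j+1)` the initial exponent is then constant. Some `D^β
Δ(0)` is nonzero and `β` has finitely many predecessors, so on a small ball the process stops. In
the algebraic case the `X_j` are algebraic because derivatives of Nash functions are Nash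
(`isAlgebraic_derivation`, applied to Taylor series at `0`). -/

namespace RadiusControl

/-! ### Weighted `ℓ¹` norms of power series -/

section WeightedNorm

variable {𝕂 : Type*} [RCLike 𝕂] {σ : Type*}

/-- The weighted `ℓ¹` norm `∑ |F_γ| s^{|γ|}` of a formal power series. -/
noncomputable def wnorm (s : ℝ≥0∞) (F : MvPowerSeries σ 𝕂) : ℝ≥0∞ :=
  ∑' γ : σ →₀ ℕ, ‖MvPowerSeries.coeff γ F‖ₑ * s ^ γ.degree

theorem wnorm_mono {s t : ℝ≥0∞} (h : s ≤ t) (F : MvPowerSeries σ 𝕂) : wnorm s F ≤ wnorm t F :=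
  ENNReal.tsum_le_tsum fun γ => by gcongr

theorem enorm_coeff_mul_le_wnorm (s : ℝ≥0∞) (F : MvPowerSeries σ 𝕂) (γ : σ →₀ ℕ) :
    ‖MvPowerSeries.coeff γ F‖ₑ * s ^ γ.degree ≤ wnorm s F :=
  ENNReal.le_tsum (f := fun γ : σ →₀ ℕ => ‖MvPowerSeries.coeff γ F‖ₑ * s ^ γ.degree) γ

@[simp]
theorem wnorm_zero (s : ℝ≥0∞) : wnorm s (0 : MvPowerSeries σ 𝕂) = 0 := by
  simp [wnorm]

theorem wnorm_add_le (s : ℝ≥0∞) (F G : MvPowerSeries σ 𝕂) :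
    wnorm s (F + G) ≤ wnorm s F + wnorm s G := by
  unfold wnorm
  rw [← ENNReal.tsum_add]
  refine ENNReal.tsum_le_tsum fun γ => ?_
  rw [← add_mul, map_add]
  gcongr
  exact enorm_add_le _ _

theorem wnorm_neg (s : ℝ≥0∞) (F : MvPowerSeries σ 𝕂) : wnorm s (-F) = wnorm s F := by
  simp [wnorm]

theorem wnorm_sub_le (s : ℝ≥0∞) (F G : MvPowerSeries σ 𝕂) :
    wnorm s (F - G) ≤ wnorm s F + wnorm s G := by
  rw [sub_eq_add_neg, ← wnorm_neg s G]
  exact wnorm_add_le _ _ _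

theorem wnorm_sum_le {ι : Type*} (s : ℝ≥0∞) (I : Finset ι) (F : ι → MvPowerSeries σ 𝕂) :
    wnorm s (∑ i ∈ I, F i) ≤ ∑ i ∈ I, wnorm s (F i) :=
  Finset.le_sum_of_subadditive _ (wnorm_zero s).le (wnorm_add_le s) _ _

theorem wnorm_nsmul (s : ℝ≥0∞) (m : ℕ) (F : MvPowerSeries σ 𝕂) :
    wnorm s (m • F) = m * wnorm s F := by
  unfold wnorm
  rw [← ENNReal.tsum_mul_left]
  refine tsum_congr fun γ => ?_
  rw [map_nsmul, nsmul_eq_mul, enorm_mul, mul_assoc]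
  congr 1
  rw [enorm_eq_nnnorm]
  simp

theorem wnorm_mul_le (s : ℝ≥0∞) (F G : MvPowerSeries σ 𝕂) :
    wnorm s (F * G) ≤ wnorm s F * wnorm s G := by
  classical
  have h1 : wnorm s F * wnorm s G = ∑' p : (σ →₀ ℕ) × (σ →₀ ℕ),
      (‖MvPowerSeries.coeff p.1 F‖ₑ * s ^ p.1.degree) *
        (‖MvPowerSeries.coeff p.2 G‖ₑ * s ^ p.2.degree) := by
    rw [ENNReal.tsum_prod']
    simp only [wnorm, ENNReal.tsum_mul_left, ENNReal.tsum_mul_right]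
  rw [h1, ← (Finset.HasAntidiagonal.sigmaAntidiagonalEquivProd (A := σ →₀ ℕ)).tsum_eq,
    ENNReal.tsum_sigma']
  refine ENNReal.tsum_le_tsum fun γ => ?_
  rw [MvPowerSeries.coeff_mul, tsum_fintype]
  simp only [Finset.HasAntidiagonal.sigmaAntidiagonalEquivProd_apply]
  rw [Finset.univ_eq_attach, Finset.sum_attach (Finset.HasAntidiagonal.antidiagonal γ)
    (fun p => (‖MvPowerSeries.coeff p.1 F‖ₑ * s ^ p.1.degree) *
        (‖MvPowerSeries.coeff p.2 G‖ₑ * s ^ p.2.degree))]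
  calc _ ≤ (∑ p ∈ Finset.HasAntidiagonal.antidiagonal γ,
          ‖MvPowerSeries.coeff p.1 F * MvPowerSeries.coeff p.2 G‖ₑ) * s ^ γ.degree := by
        gcongr
        exact enorm_sum_le _ _
    _ = _ := by
        rw [Finset.sum_mul]
        refine Finset.sum_congr rfl fun p hp => ?_
        rw [← Finset.HasAntidiagonal.mem_antidiagonal.1 hp, map_add, pow_add, enorm_mul]
        ring

/-- The left side is one term of the binomial expansion of the right side. This is Cauchy's estimate
for a single monomial. -/
theorem succ_mul_pow_mul_le_add_pow (s h : ℝ≥0∞) (k : ℕ) :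
    ((k + 1 : ℕ) : ℝ≥0∞) * s ^ k * h ≤ (s + h) ^ (k + 1) := by
  induction k with
  | zero => simp
  | succ k ih =>
    calc ((k + 1 + 1 : ℕ) : ℝ≥0∞) * s ^ (k + 1) * h
        = (((k + 1 : ℕ) : ℝ≥0∞) * s ^ k * h) * s + s ^ (k + 1) * h := by push_cast; ring
      _ ≤ (s + h) ^ (k + 1) * s + (s + h) ^ (k + 1) * h := by
          gcongr
          exact le_self_add
      _ = _ := by ring

/-- Cauchy's estimate for the weighted `ℓ¹` norm of a partial derivative. -/
theorem wnorm_pderiv_mul_le (s h : ℝ≥0∞) (i : σ) (F : MvPowerSeries σ 𝕂) :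
    wnorm s (MvPowerSeries.pderiv 𝕂 i F) * h ≤ wnorm (s + h) F := by
  have hinj : Function.Injective fun γ : σ →₀ ℕ => γ + Finsupp.single i 1 :=
    fun a b hab => by simpa using hab
  refine le_trans ?_ (ENNReal.tsum_comp_le_tsum_of_injective hinj
    (fun γ : σ →₀ ℕ => ‖MvPowerSeries.coeff γ F‖ₑ * (s + h) ^ γ.degree))
  unfold wnorm
  rw [← ENNReal.tsum_mul_right]
  refine ENNReal.tsum_le_tsum fun γ => ?_
  have h1 : ‖((γ i : 𝕂) + 1)‖ₑ ≤ ((γ.degree + 1 : ℕ) : ℝ≥0∞) := by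
    have h2 : ‖((γ i : 𝕂) + 1)‖ₑ = ((γ i + 1 : ℕ) : ℝ≥0∞) := by
      have : ((γ i : 𝕂) + 1) = ((γ i + 1 : ℕ) : 𝕂) := by push_cast; rfl
      rw [this, enorm_eq_nnnorm, RCLike.nnnorm_natCast]
      simp
    rw [h2]
    gcongr
    exact Finsupp.le_degree i γ
  rw [MvPowerSeries.coeff_pderiv, enorm_mul]
  simp only [map_add, Finsupp.degree_single]
  calc _ ≤ ‖MvPowerSeries.coeff (γ + Finsupp.single i 1) F‖ₑ * ((γ.degree + 1 : ℕ) : ℝ≥0∞) *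
          s ^ γ.degree * h := by gcongr
    _ = ‖MvPowerSeries.coeff (γ + Finsupp.single i 1) F‖ₑ *
          (((γ.degree + 1 : ℕ) : ℝ≥0∞) * s ^ γ.degree * h) := by ring
    _ ≤ _ := by
        gcongr
        exact succ_mul_pow_mul_le_add_pow _ _ _

theorem tsum_pow_sum_lt_top {x : ℝ≥0∞} (hx : x < 1) (n : ℕ) :
    ∑' f : Fin n → ℕ, x ^ (∑ i, f i) < ∞ := by
  induction n with
  | zero => simp
  | succ n ih =>
    rw [← (Fin.consEquiv fun _ => ℕ).tsum_eq, ENNReal.tsum_prod']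
    simp only [Fin.consEquiv_apply, Fin.sum_univ_succ, Fin.cons_zero, Fin.cons_succ, pow_add,
      ENNReal.tsum_mul_left, ENNReal.tsum_mul_right]
    refine ENNReal.mul_lt_top ?_ ih
    rw [ENNReal.tsum_geometric]
    simpa using hx

theorem tsum_pow_degree_lt_top {x : ℝ≥0∞} (hx : x < 1) (n : ℕ) :
    ∑' γ : Fin n →₀ ℕ, x ^ γ.degree < ∞ := by
  rw [← Finsupp.equivFunOnFinite.symm.tsum_eq]
  simpa [Finsupp.degree_eq_sum] using tsum_pow_sum_lt_top hx n

variable {n : ℕ}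

theorem prod_enorm_pow_le_of_norm_le {v : EuclideanSpace 𝕂 (Fin n)} {t : ℝ≥0∞} (h : ‖v‖ₑ ≤ t)
    (γ : Fin n →₀ ℕ) : ‖∏ i, v i ^ γ i‖ₑ ≤ t ^ γ.degree := by
  rw [enorm_eq_nnnorm, nnnorm_prod, ENNReal.ofNNReal_finsetProd, Finsupp.degree_eq_sum,
    ← Finset.prod_pow_eq_pow_sum]
  refine Finset.prod_le_prod' fun i _ => ?_
  rw [nnnorm_pow, ENNReal.coe_pow]
  gcongr
  refine le_trans ?_ h
  rw [enorm_eq_nnnorm]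
  exact_mod_cast PiLp.nnnorm_apply_le v i

theorem convergesOnBall_of_wnorm {G : MvPowerSeries (Fin n) 𝕂} {t : ℝ≥0}
    (h : wnorm (t : ℝ≥0∞) G < ∞) : ConvergesOnBall G t := by
  intro v hv
  have hv' : ‖v‖ₑ ≤ t := by
    rw [enorm_eq_nnnorm]
    exact_mod_cast hv.le
  apply Summable.of_enorm
  refine ne_of_lt (lt_of_le_of_lt (ENNReal.tsum_le_tsum fun γ => ?_) h)
  rw [enorm_mul]
  gcongr
  exact prod_enorm_pow_le_of_norm_le hv' γ

/-- Convergence is tested at the diagonal point `(t, …, t)`, whose Euclidean norm is `√n · t`; there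
the absolute values of the terms are those of the weighted norm. -/
theorem wnorm_lt_top_of_convergesOnBall {G : MvPowerSeries (Fin n) 𝕂} {r : ℝ}
    (h : ConvergesOnBall G r) {t : ℝ≥0} (ht : Real.sqrt n * t < r) :
    wnorm (t : ℝ≥0∞) G < ∞ := by
  have hv := h (WithLp.toLp 2 fun _ => ((t : ℝ) : 𝕂)) (by
    rw [EuclideanSpace.norm_eq]
    simpa [Real.sqrt_mul] using ht)
  have h1 : Summable fun γ : Fin n →₀ ℕ =>
      ‖MvPowerSeries.coeff γ G * ∏ i, ((t : ℝ) : 𝕂) ^ γ i‖₊ :=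
    NNReal.summable_coe.1 hv.norm
  refine lt_of_le_of_lt (ENNReal.tsum_le_tsum fun γ => le_of_eq ?_)
    (lt_top_iff_ne_top.2 (ENNReal.tsum_coe_ne_top_iff_summable.2 h1))
  rw [nnnorm_mul, nnnorm_prod, ENNReal.coe_mul, enorm_eq_nnnorm]
  simp [Finset.prod_pow_eq_pow_sum, Finsupp.degree_eq_sum]

end WeightedNorm

/-! ### The formal chain rule -/

section ChainRule

theorem pderiv_aeval {R σ τ : Type*} [CommRing R] [Fintype σ]
    (a : σ → MvPowerSeries τ R) (j : τ) (p : MvPolynomial σ R) :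
    MvPowerSeries.pderiv R j (MvPolynomial.aeval a p) =
      ∑ i, MvPolynomial.aeval a (MvPolynomial.pderiv i p) * MvPowerSeries.pderiv R j (a i) := by
  classical
  induction p using MvPolynomial.induction_on with
  | C c => simp
  | add p q hp hq => simp [hp, hq, add_mul, Finset.sum_add_distrib]
  | mul_X p k hp =>
    simp only [map_mul, MvPolynomial.aeval_X, Derivation.leibniz, smul_eq_mul, hp,
      MvPolynomial.pderiv_X, map_add, add_mul, Finset.sum_add_distrib, Finset.mul_sum]
    congr 1
    · rw [Finset.sum_eq_single k]
      · simp
      · intro i _ hi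
        simp [hi.symm]
      · simp
    · exact Finset.sum_congr rfl fun i _ => by ring

open MvPowerSeries.WithPiTopology in
theorem continuous_formal_pderiv {R σ : Type*} [CommRing R] [TopologicalSpace R]
    [IsTopologicalRing R] (k : σ) : Continuous (MvPowerSeries.pderiv R k) := by
  refine continuous_pi fun γ => ?_
  have h : (fun F : MvPowerSeries σ R => MvPowerSeries.pderiv R k F γ) =
      fun F => MvPowerSeries.coeff (γ + Finsupp.single k 1) F * ((γ k : R) + 1) :=
    funext fun F => MvPowerSeries.coeff_pderiv F γ
  rw [h]
  exact (continuous_coeff R _).mul continuous_const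

open MvPowerSeries.WithPiTopology in
/-- The chain rule for the substitution of formal power series. -/
theorem pderiv_subst {R σ τ : Type*} [CommRing R] [Fintype σ]
    {a : σ → MvPowerSeries τ R} (ha : MvPowerSeries.HasSubst a) (j : τ) (G : MvPowerSeries σ R) :
    MvPowerSeries.pderiv R j (MvPowerSeries.subst a G) =
      ∑ i, MvPowerSeries.subst a (MvPowerSeries.pderiv R i G) * MvPowerSeries.pderiv R j (a i) := by
  -- With the discrete topology on `R`, substitution is continuous and polynomials are dense, so the
  -- identity extends from polynomials to all series.
  let _ : UniformSpace R := ⊥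
  have : DiscreteUniformity R := ⟨rfl⟩
  have hs := MvPowerSeries.continuous_subst (R := R) ha
  suffices h : (fun G : MvPowerSeries σ R =>
      MvPowerSeries.pderiv R j (MvPowerSeries.subst a G)) = fun G =>
      ∑ i, MvPowerSeries.subst a (MvPowerSeries.pderiv R i G) *
        MvPowerSeries.pderiv R j (a i) from congrFun h G
  refine (denseRange_toMvPowerSeries (R := R) (σ := σ)).equalizer ?_ ?_ ?_
  · exact (continuous_formal_pderiv j).comp hs
  · exact continuous_finsetSum _ fun i _ =>
      (hs.comp (continuous_formal_pderiv i)).mul continuous_const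
  · funext p
    simp only [Function.comp_apply, MvPowerSeries.subst_coe, MvPowerSeries.pderiv_coe]
    exact pderiv_aeval a j p

end ChainRule

/-! ### Initial exponents in the graded lexicographic order -/

section LeadingCoefficient

variable {R σ : Type*} [CommRing R] [LinearOrder σ]

/-- All coefficients of `F` at exponents below `α`, in the graded lexicographic order, vanish. -/
def VanishesBelow (α : σ →₀ ℕ) (F : MvPowerSeries σ R) : Prop :=
  ∀ γ, toDegLex γ < toDegLex α → MvPowerSeries.coeff γ F = 0

theorem vanishesBelow_zero (F : MvPowerSeries σ R) : VanishesBelow 0 F := by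
  intro γ hγ
  exact absurd hγ (not_lt.2 (bot_le (a := toDegLex γ)))

theorem VanishesBelow.mul {α β : σ →₀ ℕ} {F G : MvPowerSeries σ R}
    (hF : VanishesBelow α F) (hG : VanishesBelow β G) : VanishesBelow (α + β) (F * G) := by
  intro γ hγ
  classical
  rw [MvPowerSeries.coeff_mul]
  refine Finset.sum_eq_zero fun p hp => ?_
  rcases lt_or_ge (toDegLex p.1) (toDegLex α) with h | h
  · rw [hF _ h, zero_mul]
  rcases lt_or_ge (toDegLex p.2) (toDegLex β) with h' | h'
  · rw [hG _ h', mul_zero]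
  exfalso
  rw [← Finset.HasAntidiagonal.mem_antidiagonal.1 hp, toDegLex_add, toDegLex_add] at hγ
  exact absurd hγ (not_lt.2 (add_le_add h h'))

/-- The order is compatible with addition: a pair other than `(α, β)` with sum `α + β` has its first
entry below `α` or its second below `β`. -/
theorem coeff_add_mul_of_vanishesBelow {α β : σ →₀ ℕ} {F G : MvPowerSeries σ R}
    (hF : VanishesBelow α F) (hG : VanishesBelow β G) :
    MvPowerSeries.coeff (α + β) (F * G) =
      MvPowerSeries.coeff α F * MvPowerSeries.coeff β G := by
  classical
  rw [MvPowerSeries.coeff_mul]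
  refine Finset.sum_eq_single (α, β) (fun p hp hne => ?_) (by simp)
  rcases lt_trichotomy (toDegLex p.1) (toDegLex α) with h | h | h
  · rw [hF _ h, zero_mul]
  · exfalso
    apply hne
    have h1 : p.1 = α := h
    have h2 := Finset.HasAntidiagonal.mem_antidiagonal.1 hp
    rw [h1] at h2
    exact Prod.ext h1 (add_left_cancel h2)
  · rcases lt_or_ge (toDegLex p.2) (toDegLex β) with h' | h'
    · rw [hG _ h', mul_zero]
    · exfalso
      have h2 := add_lt_add_of_lt_of_le h h'
      rw [← toDegLex_add, ← toDegLex_add, Finset.HasAntidiagonal.mem_antidiagonal.1 hp] at h2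
      exact lt_irrefl _ h2

theorem VanishesBelow.pow {α : σ →₀ ℕ} {F : MvPowerSeries σ R} (hF : VanishesBelow α F) (m : ℕ) :
    VanishesBelow (m • α) (F ^ m) ∧
      MvPowerSeries.coeff (m • α) (F ^ m) = MvPowerSeries.coeff α F ^ m := by
  induction m with
  | zero => simp [vanishesBelow_zero]
  | succ m ih =>
    rw [succ_nsmul, pow_succ, pow_succ]
    exact ⟨ih.1.mul hF, by rw [coeff_add_mul_of_vanishesBelow ih.1 hF, ih.2]⟩

/-- Replaces division by `F ^ m`: a bound on the product bounds the value of `H` at the centre, even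
where `F` vanishes. -/
theorem coeff_nsmul_pow_mul {α : σ →₀ ℕ} {F : MvPowerSeries σ R} (hF : VanishesBelow α F)
    (m : ℕ) (H : MvPowerSeries σ R) :
    MvPowerSeries.coeff (m • α) (F ^ m * H) =
      MvPowerSeries.coeff α F ^ m * MvPowerSeries.constantCoeff H := by
  have := coeff_add_mul_of_vanishesBelow (hF.pow m).1 (vanishesBelow_zero H)
  rwa [add_zero, (hF.pow m).2, MvPowerSeries.coeff_zero_eq_constantCoeff_apply] at this

end LeadingCoefficient

/-! ### Iterated formal derivatives -/

section IteratedDerivative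

variable {R σ : Type*} [CommRing R] [Fintype σ]

/-- The iterated formal derivative `∂^β G`. -/
noncomputable def multiPderiv (β : σ →₀ ℕ) (G : MvPowerSeries σ R) : MvPowerSeries σ R :=
  fun γ => ((∏ i, (γ i + β i).descFactorial (β i) : ℕ) : R) * MvPowerSeries.coeff (γ + β) G

theorem coeff_multiPderiv (β γ : σ →₀ ℕ) (G : MvPowerSeries σ R) :
    MvPowerSeries.coeff γ (multiPderiv β G) =
      ((∏ i, (γ i + β i).descFactorial (β i) : ℕ) : R) * MvPowerSeries.coeff (γ + β) G := rfl

@[simp]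
theorem multiPderiv_zero (G : MvPowerSeries σ R) : multiPderiv 0 G = G := by
  ext γ
  simp [coeff_multiPderiv]

theorem constantCoeff_multiPderiv (β : σ →₀ ℕ) (G : MvPowerSeries σ R) :
    MvPowerSeries.constantCoeff (multiPderiv β G) =
      ((∏ i, (β i).factorial : ℕ) : R) * MvPowerSeries.coeff β G := by
  rw [← MvPowerSeries.coeff_zero_eq_constantCoeff_apply, coeff_multiPderiv]
  simp [Nat.descFactorial_self]

/-- Ties the closed formula for `∂^β` to the recursion; the falling factorials at all directions
other than `i` are unchanged. -/
theorem pderiv_multiPderiv (i : σ) (β : σ →₀ ℕ) (G : MvPowerSeries σ R) :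
    MvPowerSeries.pderiv R i (multiPderiv β G) = multiPderiv (β + Finsupp.single i 1) G := by
  classical
  ext γ
  rw [MvPowerSeries.coeff_pderiv, coeff_multiPderiv, coeff_multiPderiv,
    add_right_comm γ, add_assoc γ β, mul_right_comm]
  congr 1
  rw [← Finset.mul_prod_erase _ _ (Finset.mem_univ i),
    ← Finset.mul_prod_erase _ _ (Finset.mem_univ i)]
  have h1 : ∏ k ∈ Finset.univ.erase i,
      ((γ + Finsupp.single i 1 : σ →₀ ℕ) k + β k).descFactorial (β k) =
      ∏ k ∈ Finset.univ.erase i, (γ k + (β + Finsupp.single i 1 : σ →₀ ℕ) k).descFactorial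
        ((β + Finsupp.single i 1 : σ →₀ ℕ) k) := by
    refine Finset.prod_congr rfl fun k hk => ?_
    have hk' : k ≠ i := Finset.ne_of_mem_erase hk
    simp [hk'.symm]
  rw [h1]
  have h2 : γ i + (β i + 1) - β i = γ i + 1 := by omega
  have h3 : γ i + 1 + β i = γ i + (β i + 1) := by omega
  simp only [Finsupp.add_apply, Finsupp.single_eq_same, Nat.descFactorial_succ, h2, h3]
  push_cast
  ring

end IteratedDerivative

/-! ### Cramer's rule and the denominator-free recursion -/

section Recursion

variable {R : Type*} [CommRing R] {n : ℕ}

/-- The formal Jacobian matrix of a tuple of power series. -/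
noncomputable def formalJacobian (a : Fin n → MvPowerSeries (Fin n) R) :
    Matrix (Fin n) (Fin n) (MvPowerSeries (Fin n) R) :=
  Matrix.of fun i j => MvPowerSeries.pderiv R j (a i)

/-- The chain rule writes the gradient of `G ∘ a` as a row vector times the Jacobian matrix;
multiplying by the adjugate inverts it up to the determinant. -/
theorem det_mul_subst_pderiv {a : Fin n → MvPowerSeries (Fin n) R}
    (ha : MvPowerSeries.HasSubst a) (i : Fin n) (G : MvPowerSeries (Fin n) R) :
    (formalJacobian a).det * MvPowerSeries.subst a (MvPowerSeries.pderiv R i G) =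
      ∑ j, (formalJacobian a).adjugate j i *
        MvPowerSeries.pderiv R j (MvPowerSeries.subst a G) := by
  set J := formalJacobian a with hJ
  set v : Fin n → MvPowerSeries (Fin n) R :=
    fun k => MvPowerSeries.subst a (MvPowerSeries.pderiv R k G) with hv
  have h1 : (fun j => MvPowerSeries.pderiv R j (MvPowerSeries.subst a G)) =
      Matrix.vecMul v J := by
    funext j
    rw [pderiv_subst ha]
    rfl
  have h2 : Matrix.vecMul (Matrix.vecMul v J) J.adjugate i = J.det * v i := by
    rw [Matrix.vecMul_vecMul, Matrix.mul_adjugate, Matrix.vecMul_smul, Matrix.vecMul_one]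
    rfl
  rw [← h2, ← h1]
  simp only [Matrix.vecMul, dotProduct]
  exact Finset.sum_congr rfl fun j _ => mul_comm _ _

/-- The recursion for the numerators `Δ^{2m} · (∂^β G ∘ φ)`, which is free of denominators. -/
theorem det_pow_mul_subst_pderiv {a : Fin n → MvPowerSeries (Fin n) R}
    (ha : MvPowerSeries.HasSubst a) (i : Fin n) (m : ℕ) (G : MvPowerSeries (Fin n) R) :
    (formalJacobian a).det ^ (2 * (m + 1)) *
        MvPowerSeries.subst a (MvPowerSeries.pderiv R i G) =
      ∑ j, (formalJacobian a).adjugate j i *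
        ((formalJacobian a).det * MvPowerSeries.pderiv R j
            ((formalJacobian a).det ^ (2 * m) * MvPowerSeries.subst a G) -
          (2 * m) • (MvPowerSeries.pderiv R j (formalJacobian a).det *
            ((formalJacobian a).det ^ (2 * m) * MvPowerSeries.subst a G))) := by
  set D := (formalJacobian a).det with hD
  have h1 : ∀ j, D * MvPowerSeries.pderiv R j (D ^ (2 * m) * MvPowerSeries.subst a G) -
      (2 * m) • (MvPowerSeries.pderiv R j D * (D ^ (2 * m) * MvPowerSeries.subst a G)) =
      D ^ (2 * m + 1) * MvPowerSeries.pderiv R j (MvPowerSeries.subst a G) := by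
    intro j
    rw [Derivation.leibniz, Derivation.leibniz_pow]
    -- The power rule has the truncated exponent `2 * m - 1`, so `2 * m = 0` is treated apart.
    rcases Nat.eq_zero_or_pos (2 * m) with h | h
    · simp [h]
    · obtain ⟨k, hk⟩ := Nat.exists_eq_succ_of_ne_zero h.ne'
      rw [hk]
      simp only [smul_eq_mul, nsmul_eq_mul, Nat.succ_eq_add_one, Nat.add_sub_cancel]
      ring
  simp only [h1]
  calc _ = D ^ (2 * m + 1) * (D * MvPowerSeries.subst a (MvPowerSeries.pderiv R i G)) := by ring
    _ = _ := by
      rw [hD, det_mul_subst_pderiv ha, Finset.mul_sum]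
      exact Finset.sum_congr rfl fun j _ => by ring

end Recursion

/-- The quotient `|β|! / β!` is a multinomial coefficient, hence one term of `(1 + ⋯ + 1)^|β| =
n^|β|`. -/
theorem factorial_degree_le {n : ℕ} (β : Fin n →₀ ℕ) :
    β.degree.factorial ≤ n ^ β.degree * ∏ i, (β i).factorial := by
  set m := β.degree with hm
  have hdeg : ∑ i, β i = m := (Finsupp.degree_eq_sum β).symm
  have h3 := Nat.multinomial_spec Finset.univ β
  rw [hdeg] at h3
  rw [← h3, mul_comm]
  gcongr
  have h4 := Finset.sum_pow_eq_sum_piAntidiag (Finset.univ : Finset (Fin n))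
    (fun _ => (1 : ℕ)) m
  simp only [Finset.sum_const, Finset.card_univ, Fintype.card_fin, smul_eq_mul, mul_one,
    one_pow, Finset.prod_const_one, Nat.cast_id] at h4
  rw [h4]
  refine Finset.single_le_sum (f := fun k => Nat.multinomial Finset.univ k)
    (fun _ _ => Nat.zero_le _) ?_
  simp [Finset.mem_piAntidiag, hdeg]

/-- Since `m^m / m! ≤ e^m ≤ 3^m`. It lets `β!` absorb the `m^m` produced by `m` Cauchy estimates of
width `s/m`. -/
theorem degree_pow_degree_le {n : ℕ} (β : Fin n →₀ ℕ) :
    β.degree ^ β.degree ≤ (3 * n) ^ β.degree * ∏ i, (β i).factorial := by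
  set m := β.degree with hm
  have h1 : m ^ m ≤ 3 ^ m * m.factorial := by
    have h := Real.pow_div_factorial_le_exp (x := m) (by positivity) m
    rw [div_le_iff₀ (by positivity)] at h
    have h2 : Real.exp m ≤ 3 ^ m := by
      rw [← mul_one (m : ℝ), Real.exp_nat_mul]
      gcongr
      exact (Real.exp_one_lt_d9.le.trans (by norm_num))
    have h3 : ((m ^ m : ℕ) : ℝ) ≤ ((3 ^ m * m.factorial : ℕ) : ℝ) := by
      push_cast
      exact h.trans (by gcongr)
    exact_mod_cast h3
  have h2 : m.factorial ≤ n ^ m * ∏ i, (β i).factorial := factorial_degree_le β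
  calc m ^ m ≤ 3 ^ m * m.factorial := h1
    _ ≤ 3 ^ m * (n ^ m * ∏ i, (β i).factorial) := by gcongr
    _ = _ := by rw [mul_pow]; ring

theorem exists_eq_add_single_of_degree_eq_succ {σ : Type*} {β : σ →₀ ℕ} {m : ℕ}
    (h : β.degree = m + 1) :
    ∃ (β' : σ →₀ ℕ) (i : σ), β = β' + Finsupp.single i 1 ∧ β'.degree = m := by
  classical
  have hβ : β ≠ 0 := by
    rintro rfl
    simp at h
  obtain ⟨i, hi⟩ := Finsupp.ne_iff.1 hβ
  have hle : Finsupp.single i 1 ≤ β := by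
    rw [Finsupp.single_le_iff]
    exact Nat.one_le_iff_ne_zero.2 hi
  refine ⟨β - Finsupp.single i 1, i, (tsub_add_cancel_of_le hle).symm, ?_⟩
  have := congrArg Finsupp.degree (tsub_add_cancel_of_le hle)
  rw [map_add, Finsupp.degree_single, h] at this
  omega

/-! ### Norm estimates and the radius of convergence -/

section Estimate

variable {𝕂 : Type*} [RCLike 𝕂] {n : ℕ}

/-- One step of the recursion. Each of the `n` summands has two factors bounded by `C`; the term
containing `∂Δ` needs no Cauchy estimate, hence its factor `m * h`. -/
theorem wnorm_numerator_succ {a : Fin n → MvPowerSeries (Fin n) 𝕂}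
    (ha : MvPowerSeries.HasSubst a) {C s h : ℝ≥0∞}
    (hdet : wnorm s (formalJacobian a).det ≤ C)
    (hadj : ∀ i j, wnorm s ((formalJacobian a).adjugate i j) ≤ C)
    (hpd : ∀ j, wnorm s (MvPowerSeries.pderiv 𝕂 j (formalJacobian a).det) ≤ C)
    (i : Fin n) (m : ℕ) (G : MvPowerSeries (Fin n) 𝕂) :
    wnorm s ((formalJacobian a).det ^ (2 * (m + 1)) *
        MvPowerSeries.subst a (MvPowerSeries.pderiv 𝕂 i G)) * h ≤
      n * C ^ 2 * (1 + 2 * (m * h)) *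
        wnorm (s + h) ((formalJacobian a).det ^ (2 * m) * MvPowerSeries.subst a G) := by
  rw [det_pow_mul_subst_pderiv ha]
  set D := (formalJacobian a).det
  set Q := D ^ (2 * m) * MvPowerSeries.subst a G
  have key : ∀ j, wnorm s ((formalJacobian a).adjugate j i *
      (D * MvPowerSeries.pderiv 𝕂 j Q - (2 * m) • (MvPowerSeries.pderiv 𝕂 j D * Q))) * h ≤
      C ^ 2 * (1 + 2 * (m * h)) * wnorm (s + h) Q := by
    intro j
    calc _ ≤ C * (C * wnorm s (MvPowerSeries.pderiv 𝕂 j Q) + (2 * m : ℕ) * (C * wnorm s Q)) * h := by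
          gcongr
          refine (wnorm_mul_le _ _ _).trans ?_
          gcongr
          · exact hadj j i
          refine (wnorm_sub_le _ _ _).trans ?_
          gcongr
          · exact (wnorm_mul_le _ _ _).trans (by gcongr)
          · rw [wnorm_nsmul]
            gcongr
            exact (wnorm_mul_le _ _ _).trans (by gcongr; exact hpd j)
      _ = C ^ 2 * (wnorm s (MvPowerSeries.pderiv 𝕂 j Q) * h + 2 * (m * h) * wnorm s Q) := by
          push_cast; ring
      _ ≤ C ^ 2 * (wnorm (s + h) Q + 2 * (m * h) * wnorm (s + h) Q) := by
          gcongr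
          · exact wnorm_pderiv_mul_le _ _ _ _
          · exact wnorm_mono le_self_add _
      _ = _ := by ring
  calc _ ≤ (∑ j, wnorm s ((formalJacobian a).adjugate j i *
      (D * MvPowerSeries.pderiv 𝕂 j Q - (2 * m) • (MvPowerSeries.pderiv 𝕂 j D * Q)))) * h := by
        gcongr
        exact wnorm_sum_le _ _ _
    _ ≤ ∑ j : Fin n, C ^ 2 * (1 + 2 * (m * h)) * wnorm (s + h) Q := by
        rw [Finset.sum_mul]
        exact Finset.sum_le_sum fun j _ => key j
    _ = _ := by
        simp only [Finset.sum_const, Finset.card_univ, Fintype.card_fin, nsmul_eq_mul]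
        ring

/-- At most `M` steps of equal width `h`, down from radius `s + M * h`. The condition `M * h ≤ 1`
bounds `1 + 2 * (m * h)` by `3`, so that the cost per step does not grow with `m`. -/
theorem wnorm_numerator_le {a : Fin n → MvPowerSeries (Fin n) 𝕂}
    (ha : MvPowerSeries.HasSubst a) {C s h t : ℝ≥0∞} {M : ℕ} (hM : M * h ≤ 1)
    (ht : s + M * h ≤ t)
    (hdet : wnorm t (formalJacobian a).det ≤ C)
    (hadj : ∀ i j, wnorm t ((formalJacobian a).adjugate i j) ≤ C)
    (hpd : ∀ j, wnorm t (MvPowerSeries.pderiv 𝕂 j (formalJacobian a).det) ≤ C)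
    (G : MvPowerSeries (Fin n) 𝕂) (m : ℕ) (hm : m ≤ M) (β : Fin n →₀ ℕ) (hβ : β.degree = m) :
    wnorm (s + (M - m : ℕ) * h) ((formalJacobian a).det ^ (2 * m) *
        MvPowerSeries.subst a (multiPderiv β G)) * h ^ m ≤
      (3 * n * C ^ 2) ^ m * wnorm t (MvPowerSeries.subst a G) := by
  induction m generalizing β with
  | zero =>
    rw [Finsupp.degree_eq_zero_iff] at hβ
    subst hβ
    simpa using wnorm_mono ht _
  | succ m ih =>
    obtain ⟨β', i, rfl, hβ'⟩ := exists_eq_add_single_of_degree_eq_succ hβ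
    rw [← pderiv_multiPderiv]
    have hle : s + (M - (m + 1) : ℕ) * h ≤ t := by
      refine le_trans ?_ ht
      gcongr
      omega
    have h1 := wnorm_numerator_succ ha (h := h) ((wnorm_mono hle _).trans hdet)
      (fun i j => (wnorm_mono hle _).trans (hadj i j))
      (fun j => (wnorm_mono hle _).trans (hpd j)) i m (multiPderiv β' G)
    have h2 : s + (M - (m + 1) : ℕ) * h + h = s + (M - m : ℕ) * h := by
      have : M - m = M - (m + 1) + 1 := by omega
      rw [this]
      push_cast
      ring
    rw [h2] at h1
    have h3 : 1 + 2 * (m * h) ≤ 3 := by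
      calc 1 + 2 * (m * h) ≤ 1 + 2 * (M * h) := by gcongr; omega
        _ ≤ 1 + 2 * 1 := by gcongr
        _ = 3 := by norm_num
    calc _ = wnorm (s + (M - (m + 1) : ℕ) * h) ((formalJacobian a).det ^ (2 * (m + 1)) *
          MvPowerSeries.subst a (MvPowerSeries.pderiv 𝕂 i (multiPderiv β' G))) * h * h ^ m := by
          ring
      _ ≤ n * C ^ 2 * 3 * wnorm (s + (M - m : ℕ) * h) ((formalJacobian a).det ^ (2 * m) *
            MvPowerSeries.subst a (multiPderiv β' G)) * h ^ m := by
          refine mul_le_mul_left ?_ _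
          exact h1.trans (by gcongr)
      _ = 3 * n * C ^ 2 * (wnorm (s + (M - m : ℕ) * h) ((formalJacobian a).det ^ (2 * m) *
            MvPowerSeries.subst a (multiPderiv β' G)) * h ^ m) := by ring
      _ ≤ 3 * n * C ^ 2 * ((3 * n * C ^ 2) ^ m * wnorm t (MvPowerSeries.subst a G)) := by
          exact mul_le_mul_right (ih (by omega) β' hβ') _
      _ = _ := by ring

/-- The coefficients of `G` are controlled by the norm of `G ∘ a` and by the leading coefficient
of the Jacobian determinant of `a`. -/
theorem enorm_coeff_mul_pow_le {a : Fin n → MvPowerSeries (Fin n) 𝕂}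
    (ha : MvPowerSeries.HasSubst a) (ha0 : ∀ i, MvPowerSeries.constantCoeff (a i) = 0)
    {C s : ℝ≥0∞} (hs : s ≤ 1)
    (hdet : wnorm (2 * s) (formalJacobian a).det ≤ C)
    (hadj : ∀ i j, wnorm (2 * s) ((formalJacobian a).adjugate i j) ≤ C)
    (hpd : ∀ j, wnorm (2 * s) (MvPowerSeries.pderiv 𝕂 j (formalJacobian a).det) ≤ C)
    {α : Fin n →₀ ℕ} (hα : VanishesBelow α (formalJacobian a).det)
    (G : MvPowerSeries (Fin n) 𝕂) (β : Fin n →₀ ℕ) :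
    ‖MvPowerSeries.coeff β G‖ₑ *
        (‖MvPowerSeries.coeff α (formalJacobian a).det‖ₑ ^ 2 * s ^ (2 * α.degree + 1)) ^ β.degree ≤
      (9 * n ^ 2 * C ^ 2) ^ β.degree * wnorm (2 * s) (MvPowerSeries.subst a G) := by
  set D := (formalJacobian a).det with hD
  set M := β.degree with hM
  -- For `M = 0` the quotient `s / M` is a division by zero, harmless because only its `M`-th power
  -- matters.
  have hMh : ((M : ℝ≥0∞) * (s / M)) ^ M = s ^ M := by
    rcases Nat.eq_zero_or_pos M with h | h
    · simp [h]
    · rw [ENNReal.mul_div_cancel (by exact_mod_cast h.ne') (by simp)]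
  have hMh' : (M : ℝ≥0∞) * (s / M) ≤ s := ENNReal.mul_div_le
  have h1 := wnorm_numerator_le (M := M) (h := s / M) ha (hMh'.trans hs)
    (by rw [two_mul]; gcongr) hdet hadj hpd G M le_rfl β rfl
  rw [Nat.sub_self, Nat.cast_zero, zero_mul, add_zero] at h1
  -- The coefficient at `2Mα` isolates the constant term of `∂^β G ∘ a`, which is `β! · G_β`.
  have h2 := enorm_coeff_mul_le_wnorm s (D ^ (2 * M) * MvPowerSeries.subst a (multiPderiv β G))
    ((2 * M) • α)
  have h0 : MvPowerSeries.constantCoeff (MvPowerSeries.subst a (multiPderiv β G)) =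
      MvPowerSeries.constantCoeff (multiPderiv β G) := by
    have h3 : multiPderiv β G = (multiPderiv β G - MvPowerSeries.C
        (MvPowerSeries.constantCoeff (multiPderiv β G))) + MvPowerSeries.C
        (MvPowerSeries.constantCoeff (multiPderiv β G)) := by ring
    have h4 := MvPowerSeries.constantCoeff_subst_eq_zero ha ha0
      (f := multiPderiv β G - MvPowerSeries.C (MvPowerSeries.constantCoeff (multiPderiv β G)))
      (by simp)
    rw [MvPowerSeries.subst_sub ha, map_sub, MvPowerSeries.subst_C, MvPowerSeries.constantCoeff_C,
      sub_eq_zero] at h4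
    exact h4
  rw [coeff_nsmul_pow_mul hα, h0, constantCoeff_multiPderiv] at h2
  set P := ∏ i, (β i).factorial with hP
  have hP0 : (P : ℝ≥0∞) ≠ 0 := by
    exact_mod_cast (Finset.prod_pos fun i _ => Nat.factorial_pos _).ne'
  have hPe : ‖(P : 𝕂)‖ₑ = P := by
    rw [enorm_eq_nnnorm, RCLike.nnnorm_natCast]
    simp
  rw [enorm_mul, enorm_mul, hPe, enorm_pow] at h2
  have h5 : ((M : ℝ≥0∞)) ^ M ≤ (3 * n) ^ M * P := by
    exact_mod_cast degree_pow_degree_le β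
  refine (ENNReal.mul_le_mul_iff_right hP0 (ENNReal.natCast_ne_top P)).1 ?_
  set c := ‖MvPowerSeries.coeff α D‖ₑ
  calc (P : ℝ≥0∞) * (‖MvPowerSeries.coeff β G‖ₑ * (c ^ 2 * s ^ (2 * α.degree + 1)) ^ M)
      = (c ^ (2 * M) * (P * ‖MvPowerSeries.coeff β G‖ₑ)) * s ^ ((2 * M) • α).degree * s ^ M := by
        rw [map_nsmul, smul_eq_mul, mul_pow, ← pow_mul, ← pow_mul, add_mul, one_mul, pow_add]
        ring
    _ = (c ^ (2 * M) * (P * ‖MvPowerSeries.coeff β G‖ₑ)) * s ^ ((2 * M) • α).degree *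
          (s / M) ^ M * M ^ M := by
        rw [← hMh, mul_pow]
        ring
    _ ≤ (3 * n * C ^ 2) ^ M * wnorm (2 * s) (MvPowerSeries.subst a G) * ((3 * n) ^ M * P) := by
        refine mul_le_mul' ?_ h5
        exact le_trans (mul_le_mul_left h2 _) h1
    _ = (P : ℝ≥0∞) * (((3 * n) * (3 * n * C ^ 2)) ^ M *
          wnorm (2 * s) (MvPowerSeries.subst a G)) := by
        rw [mul_pow (3 * n : ℝ≥0∞) (3 * n * C ^ 2)]
        ring
    _ = _ := by
        congr 3
        ring

/-- The coefficient bound compares `G` at radius `t` with a geometric series of ratio `x < 1`. -/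
theorem le_convergenceRadius {a : Fin n → MvPowerSeries (Fin n) 𝕂}
    (ha : MvPowerSeries.HasSubst a) (ha0 : ∀ i, MvPowerSeries.constantCoeff (a i) = 0)
    {C s : ℝ≥0} (hs : s ≤ 1)
    (hdet : wnorm (2 * s) (formalJacobian a).det ≤ C)
    (hadj : ∀ i j, wnorm (2 * s) ((formalJacobian a).adjugate i j) ≤ C)
    (hpd : ∀ j, wnorm (2 * s) (MvPowerSeries.pderiv 𝕂 j (formalJacobian a).det) ≤ C)
    {α : Fin n →₀ ℕ} (hα : VanishesBelow α (formalJacobian a).det)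
    {G : MvPowerSeries (Fin n) 𝕂} (hG : wnorm (2 * s) (MvPowerSeries.subst a G) < ∞) {t : ℝ≥0}
    (ht : t * (9 * n ^ 2 * C ^ 2) <
      ‖MvPowerSeries.coeff α (formalJacobian a).det‖₊ ^ 2 * s ^ (2 * α.degree + 1)) :
    (t : ℝ≥0∞) ≤ convergenceRadius G := by
  refine le_iSup₂_of_le t (convergesOnBall_of_wnorm ?_) le_rfl
  set κ : ℝ≥0 := ‖MvPowerSeries.coeff α (formalJacobian a).det‖₊ ^ 2 * s ^ (2 * α.degree + 1)
  have hκ : 0 < κ := lt_of_le_of_lt (by simp) ht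
  set x : ℝ≥0 := t * (9 * n ^ 2 * C ^ 2) / κ with hx
  have hx1 : (x : ℝ≥0∞) < 1 := by
    exact ENNReal.coe_lt_one_iff.2 ((div_lt_one hκ).2 ht)
  set B := wnorm (2 * s) (MvPowerSeries.subst a G)
  have key : ∀ β : Fin n →₀ ℕ,
      ‖MvPowerSeries.coeff β G‖ₑ * (t : ℝ≥0∞) ^ β.degree ≤ B * (x : ℝ≥0∞) ^ β.degree := by
    intro β
    have h1 := enorm_coeff_mul_pow_le ha ha0 (C := C) (s := s) (by exact_mod_cast hs)
      hdet hadj hpd hα G β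
    have h2 : ‖MvPowerSeries.coeff α (formalJacobian a).det‖ₑ ^ 2 * (s : ℝ≥0∞) ^ (2 * α.degree + 1)
        = κ := by
      simp [κ, enorm_eq_nnnorm]
    rw [h2] at h1
    have hκ0 : ((κ ^ β.degree : ℝ≥0) : ℝ≥0∞) ≠ 0 := by
      exact_mod_cast (pow_pos hκ _).ne'
    refine (ENNReal.mul_le_mul_iff_left hκ0 ENNReal.coe_ne_top).1 ?_
    have h3 : (x : ℝ≥0∞) * κ = t * (9 * n ^ 2 * C ^ 2) := by
      have : x * κ = t * (9 * n ^ 2 * C ^ 2) := div_mul_cancel₀ _ hκ.ne'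
      exact_mod_cast this
    calc _ = (‖MvPowerSeries.coeff β G‖ₑ * (κ : ℝ≥0∞) ^ β.degree) * (t : ℝ≥0∞) ^ β.degree := by
          push_cast; ring
      _ ≤ ((9 * n ^ 2 * C ^ 2) ^ β.degree * B) * (t : ℝ≥0∞) ^ β.degree := by gcongr
      _ = B * ((x : ℝ≥0∞) * κ) ^ β.degree := by rw [h3, mul_pow (t : ℝ≥0∞)]; ring
      _ = _ := by rw [mul_pow]; push_cast; ring
  refine lt_of_le_of_lt (ENNReal.tsum_le_tsum key) ?_
  rw [ENNReal.tsum_mul_left]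
  exact ENNReal.mul_lt_top hG (tsum_pow_degree_lt_top hx1 n)

end Estimate

/-! ### Taylor expansion as a ring homomorphism commuting with derivations -/

section Taylor

variable {𝕂 : Type*} [RCLike 𝕂] {n : ℕ} {a : EuclideanSpace 𝕂 (Fin n)}
  {f g : EuclideanSpace 𝕂 (Fin n) → 𝕂}

theorem analyticAt_pderiv (hf : AnalyticAt 𝕂 f a) (i : Fin n) :
    AnalyticAt 𝕂 (pderiv i f) a :=
  ((ContinuousLinearMap.apply 𝕂 𝕂 (EuclideanSpace.single i (1 : 𝕂))).analyticAt _).comp hf.fderiv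

theorem pderiv_congr (h : f =ᶠ[𝓝 a] g) (i : Fin n) : pderiv i f =ᶠ[𝓝 a] pderiv i g := by
  filter_upwards [h.fderiv (𝕜 := 𝕂)] with x hx
  simp only [pderiv, hx]

theorem pderiv_comm (hf : AnalyticAt 𝕂 f a) (i j : Fin n) :
    pderiv i (pderiv j f) =ᶠ[𝓝 a] pderiv j (pderiv i f) := by
  filter_upwards [hf.eventually_analyticAt] with x hx
  have hd : DifferentiableAt 𝕂 (fderiv 𝕂 f) x := hx.fderiv.differentiableAt
  have h : ∀ k l : Fin n, pderiv k (pderiv l f) x = fderiv 𝕂 (fderiv 𝕂 f) x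
      (EuclideanSpace.single k 1) (EuclideanSpace.single l 1) := by
    intro k l
    change fderiv 𝕂 (fun y => fderiv 𝕂 f y (EuclideanSpace.single l 1)) x _ = _
    rw [fderiv_clm_apply hd (differentiableAt_const _)]
    simp
  rw [h, h]
  exact (hx.contDiffAt (n := ⊤)).isSymmSndFDerivAt (by simp) _ _

theorem pderiv_add (hf : AnalyticAt 𝕂 f a) (hg : AnalyticAt 𝕂 g a) (i : Fin n) :
    pderiv i (f + g) =ᶠ[𝓝 a] pderiv i f + pderiv i g := by
  filter_upwards [hf.eventually_analyticAt, hg.eventually_analyticAt] with x hx hx'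
  simp [pderiv, fderiv_add hx.differentiableAt hx'.differentiableAt]

theorem pderiv_mul (hf : AnalyticAt 𝕂 f a) (hg : AnalyticAt 𝕂 g a) (i : Fin n) :
    pderiv i (f * g) =ᶠ[𝓝 a] f * pderiv i g + g * pderiv i f := by
  filter_upwards [hf.eventually_analyticAt, hg.eventually_analyticAt] with x hx hx'
  simp [pderiv, fderiv_mul hx.differentiableAt hx'.differentiableAt]

/-- The iterated partial derivative along a word in the coordinate directions. -/
noncomputable def wordDeriv (l : List (Fin n)) (f : EuclideanSpace 𝕂 (Fin n) → 𝕂) :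
    EuclideanSpace 𝕂 (Fin n) → 𝕂 :=
  l.foldr pderiv f

theorem wordDeriv_cons (i : Fin n) (l : List (Fin n)) (f : EuclideanSpace 𝕂 (Fin n) → 𝕂) :
    wordDeriv (i :: l) f = pderiv i (wordDeriv l f) := rfl

theorem wordDeriv_append (l l' : List (Fin n)) (f : EuclideanSpace 𝕂 (Fin n) → 𝕂) :
    wordDeriv (l ++ l') f = wordDeriv l (wordDeriv l' f) := by
  simp [wordDeriv, List.foldr_append]

theorem analyticAt_wordDeriv (hf : AnalyticAt 𝕂 f a) (l : List (Fin n)) :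
    AnalyticAt 𝕂 (wordDeriv l f) a := by
  induction l with
  | nil => exact hf
  | cons i l ih => exact analyticAt_pderiv ih i

theorem wordDeriv_congr (h : f =ᶠ[𝓝 a] g) (l : List (Fin n)) :
    wordDeriv l f =ᶠ[𝓝 a] wordDeriv l g := by
  induction l with
  | nil => exact h
  | cons i l ih => exact pderiv_congr ih i

/-- A permutation of words is generated by adjacent swaps, where second derivatives commute. Hence
only the letter counts of a word matter. -/
theorem wordDeriv_perm (hf : AnalyticAt 𝕂 f a) {l l' : List (Fin n)} (h : l.Perm l') :
    wordDeriv l f =ᶠ[𝓝 a] wordDeriv l' f := by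
  induction h with
  | nil => rfl
  | cons i _ ih => exact pderiv_congr ih i
  | swap i j l => exact pderiv_comm (analyticAt_wordDeriv hf l) j i
  | trans _ _ ih ih' => exact ih.trans ih'

/-- The sorted word in which each direction `i` occurs `α i` times. -/
def multiWord (α : Fin n →₀ ℕ) : List (Fin n) :=
  (List.finRange n).flatMap fun i => List.replicate (α i) i

theorem multiDeriv_eq_wordDeriv (α : Fin n →₀ ℕ) (f : EuclideanSpace 𝕂 (Fin n) → 𝕂) :
    multiDeriv α f = wordDeriv (multiWord α) f := by
  unfold multiDeriv multiWord
  induction List.finRange n with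
  | nil => rfl
  | cons i l ih =>
    rw [List.foldr_cons, List.flatMap_cons, wordDeriv_append, ih]
    generalize wordDeriv _ f = g
    induction α i with
    | zero => rfl
    | succ k ihk => rw [List.replicate_succ, wordDeriv_cons, Function.iterate_succ_apply', ihk]

theorem count_multiWord (α : Fin n →₀ ℕ) (i : Fin n) : (multiWord α).count i = α i := by
  rw [multiWord, List.count_flatMap, ← Fin.sum_univ_def]
  simp [List.count_replicate]

theorem multiDeriv_eq_of_count (hf : AnalyticAt 𝕂 f a) {α : Fin n →₀ ℕ} {l : List (Fin n)}
    (h : ∀ i, l.count i = α i) : multiDeriv α f =ᶠ[𝓝 a] wordDeriv l f := by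
  rw [multiDeriv_eq_wordDeriv]
  exact wordDeriv_perm hf (List.perm_iff_count.2 fun i => by rw [count_multiWord, h])

theorem analyticAt_multiDeriv (hf : AnalyticAt 𝕂 f a) (α : Fin n →₀ ℕ) :
    AnalyticAt 𝕂 (multiDeriv α f) a := by
  rw [multiDeriv_eq_wordDeriv]
  exact analyticAt_wordDeriv hf _

theorem multiDeriv_pderiv (hf : AnalyticAt 𝕂 f a) (α : Fin n →₀ ℕ) (i : Fin n) :
    multiDeriv α (pderiv i f) =ᶠ[𝓝 a] multiDeriv (α + Finsupp.single i 1) f := by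
  refine EventuallyEq.symm ?_
  rw [multiDeriv_eq_wordDeriv α]
  refine multiDeriv_eq_of_count hf (l := multiWord α ++ [i]) (fun j => ?_) |>.trans ?_
  · rw [List.count_append, count_multiWord]
    by_cases h : i = j
    · subst h; simp
    · simp [h]
  · rw [wordDeriv_append]
    rfl

theorem coeff_taylorSeries (f : EuclideanSpace 𝕂 (Fin n) → 𝕂) (a : EuclideanSpace 𝕂 (Fin n))
    (α : Fin n →₀ ℕ) : MvPowerSeries.coeff α (taylorSeries f a) =
      multiDeriv α f a / ((∏ i, (α i).factorial : ℕ) : 𝕂) := rfl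

theorem taylorSeries_congr (h : f =ᶠ[𝓝 a] g) : taylorSeries f a = taylorSeries g a := by
  ext α
  rw [coeff_taylorSeries, coeff_taylorSeries, multiDeriv_eq_wordDeriv, multiDeriv_eq_wordDeriv,
    (wordDeriv_congr h _).eq_of_nhds]

theorem constantCoeff_taylorSeries (f : EuclideanSpace 𝕂 (Fin n) → 𝕂)
    (a : EuclideanSpace 𝕂 (Fin n)) : MvPowerSeries.constantCoeff (taylorSeries f a) = f a := by
  rw [← MvPowerSeries.coeff_zero_eq_constantCoeff_apply, coeff_taylorSeries,
    multiDeriv_eq_wordDeriv]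
  have : multiWord (0 : Fin n →₀ ℕ) = [] := by simp [multiWord]
  rw [this]
  simp [wordDeriv]

/-- Taking Taylor series commutes with partial differentiation. -/
theorem pderiv_taylorSeries (hf : AnalyticAt 𝕂 f a) (i : Fin n) :
    MvPowerSeries.pderiv 𝕂 i (taylorSeries f a) = taylorSeries (pderiv i f) a := by
  ext α
  rw [MvPowerSeries.coeff_pderiv, coeff_taylorSeries, coeff_taylorSeries,
    (multiDeriv_pderiv hf α i).eq_of_nhds]
  have h : ∏ k, ((α + Finsupp.single i 1 : Fin n →₀ ℕ) k).factorial =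
      (α i + 1) * ∏ k, (α k).factorial := by
    rw [← Finset.mul_prod_erase _ _ (Finset.mem_univ i),
      ← Finset.mul_prod_erase _ (fun k => (α k).factorial) (Finset.mem_univ i), ← mul_assoc]
    congr 1
    · simp [Nat.factorial_succ]
    · refine Finset.prod_congr rfl fun k hk => ?_
      have hk' : k ≠ i := Finset.ne_of_mem_erase hk
      simp [hk'.symm]
  have h1 : ((∏ k, (α k).factorial : ℕ) : 𝕂) ≠ 0 := by
    exact_mod_cast (Finset.prod_pos fun k _ => Nat.factorial_pos _).ne'
  have h2 : ((α i : 𝕂) + 1) ≠ 0 := by exact_mod_cast Nat.succ_ne_zero (α i)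
  rw [h]
  push_cast at h1 ⊢
  field_simp

/-- In characteristic zero a partial derivative determines the coefficients involving that variable.
Identities of Taylor series then follow by induction on the degree. -/
theorem eq_of_pderiv_coeff {F G : MvPowerSeries (Fin n) 𝕂} {i : Fin n} {γ : Fin n →₀ ℕ}
    (h : MvPowerSeries.coeff γ (MvPowerSeries.pderiv 𝕂 i F) =
      MvPowerSeries.coeff γ (MvPowerSeries.pderiv 𝕂 i G)) :
    MvPowerSeries.coeff (γ + Finsupp.single i 1) F =
      MvPowerSeries.coeff (γ + Finsupp.single i 1) G := by
  rw [MvPowerSeries.coeff_pderiv, MvPowerSeries.coeff_pderiv] at h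
  exact mul_right_cancel₀ (by exact_mod_cast Nat.succ_ne_zero (γ i)) h

theorem taylorSeries_const (c : 𝕂) (a : EuclideanSpace 𝕂 (Fin n)) :
    taylorSeries (fun _ => c) a = MvPowerSeries.C c := by
  ext γ
  induction hd : γ.degree generalizing γ c with
  | zero =>
    rw [Finsupp.degree_eq_zero_iff] at hd
    subst hd
    simp only [MvPowerSeries.coeff_zero_eq_constantCoeff_apply, constantCoeff_taylorSeries,
      MvPowerSeries.constantCoeff_C]
  | succ d ih =>
    obtain ⟨γ, i, rfl, hγ⟩ := exists_eq_add_single_of_degree_eq_succ hd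
    apply eq_of_pderiv_coeff
    rw [pderiv_taylorSeries analyticAt_const, MvPowerSeries.pderiv_C]
    have h : pderiv i (fun _ : EuclideanSpace 𝕂 (Fin n) => c) = fun _ => 0 := by
      funext x
      simp [pderiv]
    rw [h, ih 0 γ hγ, map_zero]

theorem taylorSeries_add (hf : AnalyticAt 𝕂 f a) (hg : AnalyticAt 𝕂 g a) :
    taylorSeries (f + g) a = taylorSeries f a + taylorSeries g a := by
  ext γ
  induction hd : γ.degree generalizing γ f g with
  | zero =>
    rw [Finsupp.degree_eq_zero_iff] at hd
    subst hd
    simp only [MvPowerSeries.coeff_zero_eq_constantCoeff_apply, constantCoeff_taylorSeries,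
      map_add, Pi.add_apply]
  | succ d ih =>
    obtain ⟨γ, i, rfl, hγ⟩ := exists_eq_add_single_of_degree_eq_succ hd
    apply eq_of_pderiv_coeff
    rw [pderiv_taylorSeries (hf.add hg), map_add, pderiv_taylorSeries hf,
      pderiv_taylorSeries hg, taylorSeries_congr (pderiv_add hf hg i)]
    exact ih (analyticAt_pderiv hf i) (analyticAt_pderiv hg i) γ hγ

theorem taylorSeries_mul (hf : AnalyticAt 𝕂 f a) (hg : AnalyticAt 𝕂 g a) :
    taylorSeries (f * g) a = taylorSeries f a * taylorSeries g a := by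
  ext γ
  induction hd : γ.degree generalizing γ f g with
  | zero =>
    rw [Finsupp.degree_eq_zero_iff] at hd
    subst hd
    simp only [MvPowerSeries.coeff_zero_eq_constantCoeff_apply, constantCoeff_taylorSeries,
      map_mul, Pi.mul_apply]
  | succ d ih =>
    obtain ⟨γ, i, rfl, hγ⟩ := exists_eq_add_single_of_degree_eq_succ hd
    apply eq_of_pderiv_coeff
    have hfi := analyticAt_pderiv hf i
    have hgi := analyticAt_pderiv hg i
    rw [pderiv_taylorSeries (hf.mul hg), Derivation.leibniz, pderiv_taylorSeries hf,
      pderiv_taylorSeries hg, taylorSeries_congr (pderiv_mul hf hg i),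
      taylorSeries_add (hf.mul hgi) (hg.mul hfi), map_add, map_add, ih hf hgi γ hγ,
      ih hg hfi γ hγ]
    rfl

/-- The ring of functions analytic at a point. -/
def analyticSubring (a : EuclideanSpace 𝕂 (Fin n)) :
    Subring (EuclideanSpace 𝕂 (Fin n) → 𝕂) where
  carrier := {f | AnalyticAt 𝕂 f a}
  mul_mem' hf hg := AnalyticAt.mul hf hg
  one_mem' := analyticAt_const
  add_mem' hf hg := AnalyticAt.add hf hg
  zero_mem' := analyticAt_const
  neg_mem' hf := AnalyticAt.neg hf

/-- The Taylor expansion at a point, as a ring homomorphism. -/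
noncomputable def taylorHom (a : EuclideanSpace 𝕂 (Fin n)) :
    analyticSubring a →+* MvPowerSeries (Fin n) 𝕂 where
  toFun f := taylorSeries f.1 a
  map_one' := taylorSeries_const 1 a
  map_mul' f g := taylorSeries_mul f.2 g.2
  map_zero' := (taylorSeries_const 0 a).trans (map_zero _)
  map_add' f g := taylorSeries_add f.2 g.2

theorem analyticAt_coord (i : Fin n) (a : EuclideanSpace 𝕂 (Fin n)) :
    AnalyticAt 𝕂 (fun x : EuclideanSpace 𝕂 (Fin n) => x i) a :=
  (EuclideanSpace.proj (𝕜 := 𝕂) i).analyticAt a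

theorem taylorSeries_coord (i : Fin n) (a : EuclideanSpace 𝕂 (Fin n)) :
    taylorSeries (fun x : EuclideanSpace 𝕂 (Fin n) => x i) a =
      MvPowerSeries.C (a i) + MvPowerSeries.X i := by
  classical
  refine MvPowerSeries.pderiv.ext (fun j => ?_) ?_
  · have h : pderiv j (fun x : EuclideanSpace 𝕂 (Fin n) => x i) =
        fun _ => if j = i then 1 else 0 := by
      funext x
      change fderiv 𝕂 (EuclideanSpace.proj (𝕜 := 𝕂) i) x _ = _
      rw [ContinuousLinearMap.fderiv]
      simp [eq_comm]
    rw [pderiv_taylorSeries (analyticAt_coord i a), h, taylorSeries_const, map_add,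
      MvPowerSeries.pderiv_C, zero_add, MvPowerSeries.pderiv_X, Pi.single_apply]
    by_cases hij : j = i
    · simp [hij]
    · simp [hij, Ne.symm hij]
  · simp [constantCoeff_taylorSeries]

/-- Links coordinate derivatives to the multilinear Taylor coefficients, for which the convergence
theory is available. -/
theorem iteratedFDeriv_apply_single (hf : AnalyticAt 𝕂 f a) (k : ℕ) (w : Fin k → Fin n) :
    (fun x => iteratedFDeriv 𝕂 k f x fun j => EuclideanSpace.single (w j) (1 : 𝕂)) =ᶠ[𝓝 a]
      wordDeriv (List.ofFn w) f := by
  induction k with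
  | zero => exact Eventually.of_forall fun x => by simp [wordDeriv]
  | succ k ih =>
    rw [List.ofFn_succ, wordDeriv_cons]
    refine EventuallyEq.trans ?_ (pderiv_congr (ih fun j => w j.succ) (w 0))
    filter_upwards [hf.eventually_analyticAt] with x hx
    have hd : DifferentiableAt 𝕂 (iteratedFDeriv 𝕂 k f) x :=
      (hx.contDiffAt (n := ⊤)).differentiableAt_iteratedFDeriv (by simp)
    rw [iteratedFDeriv_succ_apply_left]
    simp only [pderiv]
    rw [fderiv_continuousMultilinear_apply_const_apply hd]
    rfl

theorem multiDeriv_eq_iteratedFDeriv (hf : AnalyticAt 𝕂 f a) (α : Fin n →₀ ℕ) :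
    ∃ w : Fin α.degree → Fin n, multiDeriv α f a =
      iteratedFDeriv 𝕂 α.degree f a fun j => EuclideanSpace.single (w j) (1 : 𝕂) := by
  have hl : (multiWord α).length = α.degree := by
    simp [multiWord, List.length_flatMap, Finsupp.degree_eq_sum, Fin.sum_univ_def]
  rw [← hl]
  refine ⟨(multiWord α).get, ?_⟩
  rw [(iteratedFDeriv_apply_single hf _ (multiWord α).get).eq_of_nhds, List.ofFn_get,
    multiDeriv_eq_wordDeriv]

/-- A function analytic at `a` with vanishing Taylor series vanishes near `a`. -/
theorem eventuallyEq_zero_of_taylorSeries_eq_zero (hf : AnalyticAt 𝕂 f a)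
    (h : taylorSeries f a = 0) : f =ᶠ[𝓝 a] 0 := by
  have h1 : ∀ α, multiDeriv α f a = 0 := by
    intro α
    have h2 := congrArg (MvPowerSeries.coeff α) h
    rw [coeff_taylorSeries, map_zero, div_eq_zero_iff] at h2
    refine h2.resolve_right ?_
    exact_mod_cast (Finset.prod_pos fun k _ => Nat.factorial_pos _).ne'
  have h2 : ∀ k, iteratedFDeriv 𝕂 k f a = 0 := by
    intro k
    apply ContinuousMultilinearMap.toMultilinearMap_injective
    refine Module.Basis.ext_multilinear
      (fun _ => (EuclideanSpace.basisFun (Fin n) 𝕂).toBasis) fun w => ?_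
    have h3 := (iteratedFDeriv_apply_single hf k w).eq_of_nhds
    rw [← (multiDeriv_eq_of_count hf (α := Finsupp.equivFunOnFinite.symm
      fun i => (List.ofFn w).count i) (fun i => rfl)).eq_of_nhds, h1] at h3
    simpa using h3
  obtain ⟨p, r, hp⟩ := hf
  filter_upwards [Metric.eball_mem_nhds a hp.r_pos] with x hx
  have h3 := hp.hasSum_iteratedFDeriv (y := x - a) (by simpa [edist_eq_enorm_sub] using hx)
  simp only [h2, add_sub_cancel] at h3
  simpa using h3.unique (by simp)

end Taylor

/-! ### Uniform bounds for Taylor series at nearby points -/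

section UniformBound

variable {𝕂 : Type*} [RCLike 𝕂] {n : ℕ}

/-- All re-expanded coefficients are dominated by parts of one summable family, which converges
because `ρ + ρ` is below the radius. -/
theorem exists_nnnorm_changeOrigin_le {E F : Type*} [NormedAddCommGroup E] [NormedSpace 𝕂 E]
    [NormedAddCommGroup F] [NormedSpace 𝕂 F] [CompleteSpace F]
    (p : FormalMultilinearSeries 𝕂 E F) {ρ : ℝ≥0} (hρ : (ρ + ρ : ℝ≥0∞) < p.radius) :
    ∃ B : ℝ≥0, ∀ a : E, ‖a‖₊ ≤ ρ → ∀ k, ‖p.changeOrigin a k‖₊ * ρ ^ k ≤ B := by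
  have hs := p.changeOriginSeries_summable_aux₁ hρ
  refine ⟨∑' s : Σ k l : ℕ, { s : Finset (Fin (k + l)) // s.card = l },
    ‖p (s.1 + s.2.1)‖₊ * ρ ^ s.2.1 * ρ ^ s.1, fun a ha k => ?_⟩
  have ha' : (‖a‖₊ : ℝ≥0∞) < p.radius :=
    lt_of_le_of_lt (by exact_mod_cast ha) (lt_of_le_of_lt le_self_add hρ)
  have hρ' : (ρ : ℝ≥0∞) < p.radius := lt_of_le_of_lt le_self_add hρ
  have h1 := (p.nnnorm_changeOrigin_le k ha').trans
    (Summable.tsum_le_tsum (fun s => mul_le_mul_right (pow_le_pow_left₀ (by simp) ha s.1) _)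
      (p.changeOriginSeries_summable_aux₂ ha' k) (p.changeOriginSeries_summable_aux₂ hρ' k))
  refine (mul_le_mul_left h1 (ρ ^ k)).trans ?_
  rw [← NNReal.tsum_mul_right]
  exact NNReal.tsum_comp_le_tsum_of_inj hs (i := Sigma.mk k) sigma_mk_injective

/-- The derivative is a sum of `|γ|!` values of `p`, one for each permutation of the arguments;
division by `γ!` leaves a multinomial coefficient. -/
theorem enorm_coeff_taylorSeries_le {f : EuclideanSpace 𝕂 (Fin n) → 𝕂}
    {a : EuclideanSpace 𝕂 (Fin n)} {p : FormalMultilinearSeries 𝕂 (EuclideanSpace 𝕂 (Fin n)) 𝕂}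
    {r : ℝ≥0∞} (hp : HasFPowerSeriesOnBall f p a r) (γ : Fin n →₀ ℕ) :
    ‖MvPowerSeries.coeff γ (taylorSeries f a)‖ₑ ≤ n ^ γ.degree * ‖p γ.degree‖ₑ := by
  obtain ⟨w, hw⟩ := multiDeriv_eq_iteratedFDeriv hp.analyticAt γ
  rw [hp.iteratedFDeriv_eq_sum_of_completeSpace] at hw
  have h1 : ‖multiDeriv γ f a‖ ≤ γ.degree.factorial * ‖p γ.degree‖ := by
    rw [hw]
    refine (norm_sum_le _ _).trans ?_
    refine (Finset.sum_le_card_nsmul _ _ ‖p γ.degree‖ fun σ _ => ?_).trans ?_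
    · refine (ContinuousMultilinearMap.le_opNorm _ _).trans ?_
      simp
    · simp [Fintype.card_perm]
  have h2 : (0 : ℝ) < ((∏ i, (γ i).factorial : ℕ) : ℝ) := by
    exact_mod_cast Finset.prod_pos fun k _ => Nat.factorial_pos _
  have h3 : ‖MvPowerSeries.coeff γ (taylorSeries f a)‖ ≤ n ^ γ.degree * ‖p γ.degree‖ := by
    rw [coeff_taylorSeries, norm_div, RCLike.norm_natCast, div_le_iff₀ h2]
    refine h1.trans ?_
    have h4 : (γ.degree.factorial : ℝ) ≤ n ^ γ.degree * ((∏ i, (γ i).factorial : ℕ) : ℝ) := by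
      exact_mod_cast factorial_degree_le γ
    calc _ ≤ (n ^ γ.degree * ((∏ i, (γ i).factorial : ℕ) : ℝ)) * ‖p γ.degree‖ := by gcongr
      _ = _ := by ring
  simp only [enorm_eq_nnnorm]
  exact_mod_cast h3

/-- The Taylor series of an analytic function at points near `0` are uniformly bounded in a
weighted `ℓ¹` norm. -/
theorem exists_wnorm_taylorSeries_le {f : EuclideanSpace 𝕂 (Fin n) → 𝕂}
    (hf : AnalyticAt 𝕂 f 0) :
    ∃ C s : ℝ≥0, 0 < s ∧ ∀ᶠ a in 𝓝 (0 : EuclideanSpace 𝕂 (Fin n)),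
      wnorm (s : ℝ≥0∞) (taylorSeries f a) ≤ C := by
  obtain ⟨p, r, hp⟩ := hf
  obtain ⟨q, hq0, hqr⟩ := ENNReal.lt_iff_exists_nnreal_btwn.1 hp.r_pos
  set ρ : ℝ≥0 := q / 2 with hρ
  have hρ0 : 0 < ρ := half_pos (by exact_mod_cast hq0)
  have hρr : (ρ + ρ : ℝ≥0∞) < r := by
    rw [← ENNReal.coe_add, hρ, add_halves]
    exact hqr
  obtain ⟨B, hB⟩ := exists_nnnorm_changeOrigin_le p (hρr.trans_le hp.r_le)
  -- Shrinking the radius by `n + 1` beats the factor `n ^ γ.degree`, leaving a summable family of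
  -- ratio `x < 1`, also for `n = 0`.
  set x : ℝ≥0 := n / (n + 1) with hx
  have hx1 : (x : ℝ≥0∞) < 1 :=
    ENNReal.coe_lt_one_iff.2 ((div_lt_one (by positivity)).2 (lt_add_one _))
  have hsum := tsum_pow_degree_lt_top hx1 n
  set S := ∑' γ : Fin n →₀ ℕ, (x : ℝ≥0∞) ^ γ.degree with hS
  refine ⟨B * S.toNNReal, ρ / (n + 1), by positivity, ?_⟩
  filter_upwards [Metric.closedBall_mem_nhds (0 : EuclideanSpace 𝕂 (Fin n)) (NNReal.coe_pos.2 hρ0)]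
    with a ha
  have ha' : ‖a‖₊ ≤ ρ := by
    rw [← NNReal.coe_le_coe]
    simpa using ha
  have hpa := hp.changeOrigin (y := a) (lt_of_le_of_lt (by exact_mod_cast ha')
    (lt_of_le_of_lt le_self_add hρr))
  rw [zero_add] at hpa
  rw [ENNReal.coe_mul, ENNReal.coe_toNNReal hsum.ne, hS, ← ENNReal.tsum_mul_left]
  refine ENNReal.tsum_le_tsum fun γ => ?_
  refine (mul_le_mul_left (enorm_coeff_taylorSeries_le hpa γ) _).trans ?_
  rw [enorm_eq_nnnorm]
  have h1 := hB a ha' γ.degree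
  have h2 : (n : ℝ≥0) ^ γ.degree * ‖p.changeOrigin a γ.degree‖₊ * (ρ / (n + 1)) ^ γ.degree ≤
      B * x ^ γ.degree := by
    calc _ = (‖p.changeOrigin a γ.degree‖₊ * ρ ^ γ.degree) * x ^ γ.degree := by
          rw [hx, div_pow, div_pow]
          ring
      _ ≤ _ := by gcongr
  exact_mod_cast h2

theorem exists_forall_wnorm_taylorSeries_le {ι : Type*} [Finite ι]
    {f : ι → EuclideanSpace 𝕂 (Fin n) → 𝕂} (hf : ∀ i, AnalyticAt 𝕂 (f i) 0) :
    ∃ C s : ℝ≥0, 0 < s ∧ ∀ᶠ a in 𝓝 (0 : EuclideanSpace 𝕂 (Fin n)),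
      ∀ i, wnorm (s : ℝ≥0∞) (taylorSeries (f i) a) ≤ C := by
  cases nonempty_fintype ι
  choose C s hs h using fun i => exists_wnorm_taylorSeries_le (hf i)
  obtain ⟨t, ht, hts⟩ : ∃ t : ℝ≥0, 0 < t ∧ ∀ i, t ≤ s i := by
    rcases isEmpty_or_nonempty ι with _ | _
    · exact ⟨1, one_pos, isEmptyElim⟩
    · obtain ⟨i, hi⟩ := Finite.exists_min s
      exact ⟨s i, hs i, hi⟩
  refine ⟨∑ i, C i, t, ht, ?_⟩
  filter_upwards [eventually_all.2 h] with a ha i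
  refine (wnorm_mono ?_ _).trans ((ha i).trans ?_)
  · exact_mod_cast hts i
  · exact_mod_cast Finset.single_le_sum (f := C) (fun _ _ => by simp) (Finset.mem_univ i)

end UniformBound

/-! ### Derivations preserve algebraicity -/

section Derivation

variable {R A B : Type*} [CommRing R] [CommRing A] [CommRing B] [Algebra R A] [Algebra R B]
  [Algebra A B]

/-- Here `q` arises from `p` by applying `d` to the coefficients. -/
theorem exists_derivation_aeval_eq (d : Derivation R A A) (d' : Derivation R B B)
    (h : ∀ a, d' (algebraMap A B a) = algebraMap A B (d a)) (x : B) (p : Polynomial A) :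
    ∃ q : Polynomial A, d' (Polynomial.aeval x p) =
      Polynomial.aeval x q + Polynomial.aeval x p.derivative * d' x := by
  induction p using Polynomial.induction_on' with
  | add p q hp hq =>
    obtain ⟨p', hp'⟩ := hp
    obtain ⟨q', hq'⟩ := hq
    refine ⟨p' + q', ?_⟩
    simp only [map_add, hp', hq']
    ring
  | monomial k c =>
    refine ⟨Polynomial.monomial k (d c), ?_⟩
    simp only [Polynomial.aeval_monomial, Derivation.leibniz, Derivation.leibniz_pow, h,
      Polynomial.derivative_monomial, map_mul, smul_eq_mul, nsmul_eq_mul, map_natCast]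
    ring

/-- A derivation that preserves the base ring maps algebraic elements to algebraic elements. -/
theorem isAlgebraic_derivation [IsDomain A] [CharZero A] [IsDomain B] [FaithfulSMul A B]
    (d : Derivation R A A) (d' : Derivation R B B)
    (h : ∀ a, d' (algebraMap A B a) = algebraMap A B (d a)) {x : B} (hx : IsAlgebraic A x) :
    IsAlgebraic A (d' x) := by
  classical
  -- A relation `p` of least degree has `p'(x) ≠ 0`. Differentiating `p(x) = 0` then gives `p'(x) ·
  -- d'x = -q(x)`.
  have hex : ∃ m, ∃ p : Polynomial A, p ≠ 0 ∧ Polynomial.aeval x p = 0 ∧ p.natDegree = m := by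
    obtain ⟨p, hp, hpx⟩ := hx
    exact ⟨_, p, hp, hpx, rfl⟩
  obtain ⟨p, hp, hpx, hpd⟩ := Nat.find_spec hex
  have hdeg : p.natDegree ≠ 0 := by
    intro h0
    rw [Polynomial.eq_C_of_natDegree_eq_zero h0] at hp hpx
    rw [Polynomial.aeval_C, FaithfulSMul.algebraMap_eq_zero_iff] at hpx
    exact hp (by rw [hpx, Polynomial.C_0])
  have hd0 : p.derivative ≠ 0 := by
    intro h0
    exact hdeg (Polynomial.derivative_eq_zero.1 h0)
  have hne : Polynomial.aeval x p.derivative ≠ 0 := by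
    intro h0
    refine Nat.find_min hex (m := p.derivative.natDegree) ?_ ⟨_, hd0, h0, rfl⟩
    rw [← hpd]
    exact Polynomial.natDegree_derivative_lt hdeg
  obtain ⟨q, hq⟩ := exists_derivation_aeval_eq d d' h x p
  have halg : ∀ r : Polynomial A, IsAlgebraic A (Polynomial.aeval x r) := fun r =>
    Algebra.isAlgebraic_adjoin_singleton_iff.2 hx _ (Polynomial.aeval_mem_adjoin_singleton A x)
  refine IsAlgebraic.of_mul (mem_nonZeroDivisors_of_ne_zero hne) (halg _) ?_
  rw [hpx, map_zero] at hq
  rw [← neg_eq_of_add_eq_zero_right hq.symm]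
  exact (halg q).neg

end Derivation

/-! ### Nash functions through their Taylor series at `0` -/

section Nash

variable {𝕂 : Type*} [RCLike 𝕂] {n : ℕ} {f : EuclideanSpace 𝕂 (Fin n) → 𝕂}

instance : FaithfulSMul (MvPolynomial (Fin n) 𝕂) (MvPowerSeries (Fin n) 𝕂) := by
  rw [faithfulSMul_iff_algebraMap_injective]
  exact MvPolynomial.coe_injective _ _

/-- Polynomials as functions analytic at `0`. -/
noncomputable def polynomialFunctions :
    MvPolynomial (Fin n) 𝕂 →+* analyticSubring (0 : EuclideanSpace 𝕂 (Fin n)) :=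
  MvPolynomial.eval₂Hom
    { toFun := fun c => ⟨fun _ => c, analyticAt_const⟩
      map_one' := rfl
      map_mul' := fun _ _ => rfl
      map_zero' := rfl
      map_add' := fun _ _ => rfl }
    fun i => ⟨fun x => x i, analyticAt_coord i 0⟩

theorem polynomialFunctions_apply (p : MvPolynomial (Fin n) 𝕂) (x : EuclideanSpace 𝕂 (Fin n)) :
    (polynomialFunctions p).1 x = MvPolynomial.eval (fun i => x i) p := by
  have h : ((Pi.evalRingHom (fun _ : EuclideanSpace 𝕂 (Fin n) => 𝕂) x).comp
      (analyticSubring 0).subtype).comp polynomialFunctions =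
      MvPolynomial.eval fun i => x i := by
    refine MvPolynomial.ringHom_ext (fun c => ?_) fun i => ?_
    · simp [polynomialFunctions]
    · simp [polynomialFunctions]
  exact congrArg (fun φ => φ p) h

theorem taylorHom_comp_polynomialFunctions :
    (taylorHom 0).comp polynomialFunctions =
      algebraMap (MvPolynomial (Fin n) 𝕂) (MvPowerSeries (Fin n) 𝕂) := by
  refine MvPolynomial.ringHom_ext (fun c => ?_) fun i => ?_
  · rw [RingHom.comp_apply, polynomialFunctions, MvPolynomial.coe_eval₂Hom, MvPolynomial.eval₂_C]
    exact (taylorSeries_const c 0).trans (MvPolynomial.coe_C c).symm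
  · rw [RingHom.comp_apply, polynomialFunctions, MvPolynomial.coe_eval₂Hom, MvPolynomial.eval₂_X]
    refine (taylorSeries_coord i 0).trans (Eq.trans ?_ (MvPolynomial.coe_X i).symm)
    simp

/-- Taylor expansion carries `P(x, f(x))` to `P` evaluated at the series of `f`, so a polynomial
relation passes between germs and series. -/
theorem analyticAt_polynomial_eval (hf : AnalyticAt 𝕂 f 0)
    (P : Polynomial (MvPolynomial (Fin n) 𝕂)) :
    AnalyticAt 𝕂 (fun x : EuclideanSpace 𝕂 (Fin n) =>
      (P.map (MvPolynomial.eval fun i => x i)).eval (f x)) 0 ∧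
    taylorSeries (fun x : EuclideanSpace 𝕂 (Fin n) =>
      (P.map (MvPolynomial.eval fun i => x i)).eval (f x)) 0 =
      Polynomial.aeval (taylorSeries f 0) P := by
  have h : (P.eval₂ polynomialFunctions ⟨f, hf⟩ : analyticSubring 0).1 =
      fun x : EuclideanSpace 𝕂 (Fin n) =>
        (P.map (MvPolynomial.eval fun i => x i)).eval (f x) := by
    funext x
    have h1 := Polynomial.hom_eval₂ P polynomialFunctions
      ((Pi.evalRingHom (fun _ : EuclideanSpace 𝕂 (Fin n) => 𝕂) x).comp
        (analyticSubring 0).subtype) ⟨f, hf⟩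
    have h2 : ((Pi.evalRingHom (fun _ : EuclideanSpace 𝕂 (Fin n) => 𝕂) x).comp
        (analyticSubring 0).subtype).comp polynomialFunctions =
        MvPolynomial.eval fun i => x i :=
      RingHom.ext fun p => polynomialFunctions_apply p x
    rw [h2] at h1
    rw [Polynomial.eval_map]
    exact h1
  rw [← h]
  refine ⟨(P.eval₂ polynomialFunctions ⟨f, hf⟩ : analyticSubring 0).2, ?_⟩
  change taylorHom 0 (P.eval₂ polynomialFunctions ⟨f, hf⟩) = _
  rw [Polynomial.hom_eval₂, taylorHom_comp_polynomialFunctions]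
  rfl

theorem IsNashOn.isAlgebraic_taylorSeries {U : Set (EuclideanSpace 𝕂 (Fin n))}
    (hU : U ∈ 𝓝 0) (hf : IsNashOn U f) :
    IsAlgebraic (MvPolynomial (Fin n) 𝕂) (taylorSeries f 0) := by
  obtain ⟨hfa, P, hP, hPf⟩ := hf
  refine ⟨P, hP, ?_⟩
  rw [← (analyticAt_polynomial_eval (hfa 0 (mem_of_mem_nhds hU)) P).2]
  refine (taylorSeries_congr (g := fun _ => 0) ?_).trans
    ((taylorSeries_const 0 _).trans (map_zero _))
  filter_upwards [hU] with x hx using hPf x hx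

/-- The relation holds formally at `0`, hence near `0`, hence on the connected set `U` by the
identity theorem. -/
theorem isNashOn_of_isAlgebraic {U : Set (EuclideanSpace 𝕂 (Fin n))} (hU : IsPreconnected U)
    (h0 : 0 ∈ U) (hf : AnalyticOnNhd 𝕂 f U)
    (halg : IsAlgebraic (MvPolynomial (Fin n) 𝕂) (taylorSeries f 0)) : IsNashOn U f := by
  obtain ⟨P, hP, hPf⟩ := halg
  refine ⟨hf, P, hP, ?_⟩
  have h := analyticAt_polynomial_eval (hf 0 h0) P
  have hev := eventuallyEq_zero_of_taylorSeries_eq_zero h.1 (h.2.trans hPf)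
  have hana : AnalyticOnNhd 𝕂 (fun x : EuclideanSpace 𝕂 (Fin n) =>
      (P.map (MvPolynomial.eval fun i => x i)).eval (f x)) U := by
    have heq : (fun x : EuclideanSpace 𝕂 (Fin n) =>
        (P.map (MvPolynomial.eval fun i => x i)).eval (f x)) = fun x =>
        ∑ k ∈ P.support, MvPolynomial.eval (fun i => x i) (P.coeff k) * f x ^ k := by
      funext x
      rw [Polynomial.eval_map, Polynomial.eval₂_eq_sum, Polynomial.sum_def]
    rw [heq]
    intro x hx
    refine Finset.analyticAt_fun_sum _ fun k _ => ?_
    refine AnalyticAt.mul ?_ ((hf x hx).pow k)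
    have := AnalyticAt.aeval_mvPolynomial (f := fun (x : EuclideanSpace 𝕂 (Fin n)) i => x i)
      (z := x) (fun i => analyticAt_coord i x) (P.coeff k)
    simpa [MvPolynomial.aeval_eq_eval] using this
  exact hana.eqOn_zero_of_preconnected_of_eventuallyEq_zero hU h0 hev

theorem isAlgebraic_taylorSeries_pderiv (hf : AnalyticAt 𝕂 f 0)
    (h : IsAlgebraic (MvPolynomial (Fin n) 𝕂) (taylorSeries f 0)) (i : Fin n) :
    IsAlgebraic (MvPolynomial (Fin n) 𝕂) (taylorSeries (pderiv i f) 0) := by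
  have : IsDomain (MvPowerSeries (Fin n) 𝕂) := NoZeroDivisors.to_isDomain _
  rw [← pderiv_taylorSeries hf]
  exact isAlgebraic_derivation (MvPolynomial.pderiv i) (MvPowerSeries.pderiv 𝕂 i)
    (fun p => MvPowerSeries.pderiv_coe p) h

theorem isAlgebraic_taylorSeries_multiDeriv (hf : AnalyticAt 𝕂 f 0)
    (h : IsAlgebraic (MvPolynomial (Fin n) 𝕂) (taylorSeries f 0)) (α : Fin n →₀ ℕ) :
    IsAlgebraic (MvPolynomial (Fin n) 𝕂) (taylorSeries (multiDeriv α f) 0) := by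
  rw [multiDeriv_eq_wordDeriv]
  induction multiWord α with
  | nil => exact h
  | cons i l ih => exact isAlgebraic_taylorSeries_pderiv (analyticAt_wordDeriv hf l) ih i

end Nash

/-! ### The Jacobian determinant and its formal counterpart -/

section Jacobian

variable {𝕂 : Type*} [RCLike 𝕂] {n : ℕ} {a : EuclideanSpace 𝕂 (Fin n)}
  {φ : EuclideanSpace 𝕂 (Fin n) → EuclideanSpace 𝕂 (Fin n)}

/-- The entries of the adjugate of the Jacobian matrix. -/
noncomputable def jacobianAdjugate (φ : EuclideanSpace 𝕂 (Fin n) → EuclideanSpace 𝕂 (Fin n))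
    (i j : Fin n) : EuclideanSpace 𝕂 (Fin n) → 𝕂 :=
  fun x => Matrix.adjugate (Matrix.of fun i j : Fin n => pderiv j (fun y => φ y i) x) i j

/-- The Jacobian matrix with entries in the ring of functions analytic at a point. -/
noncomputable def analyticJacobian (hφ : ∀ i, AnalyticAt 𝕂 (fun x => φ x i) a) :
    Matrix (Fin n) (Fin n) (analyticSubring a) :=
  Matrix.of fun i j => ⟨pderiv j (fun x => φ x i), analyticAt_pderiv (hφ i) j⟩

/-- Evaluation at a point, on the ring of functions analytic at `a`. -/
def analyticEval (a x : EuclideanSpace 𝕂 (Fin n)) : analyticSubring a →+* 𝕂 :=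
  (Pi.evalRingHom (fun _ : EuclideanSpace 𝕂 (Fin n) => 𝕂) x).comp (analyticSubring a).subtype

theorem det_analyticJacobian (hφ : ∀ i, AnalyticAt 𝕂 (fun x => φ x i) a) :
    (analyticJacobian hφ).det.1 = jacobianDet φ := by
  funext x
  exact RingHom.map_det (analyticEval a x) (analyticJacobian hφ)

theorem adjugate_analyticJacobian (hφ : ∀ i, AnalyticAt 𝕂 (fun x => φ x i) a) (i j : Fin n) :
    ((analyticJacobian hφ).adjugate i j).1 = jacobianAdjugate φ i j := by
  funext x
  exact congrArg (fun M : Matrix (Fin n) (Fin n) 𝕂 => M i j)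
    (RingHom.map_adjugate (analyticEval a x) (analyticJacobian hφ))

theorem analyticAt_jacobianDet (hφ : ∀ i, AnalyticAt 𝕂 (fun x => φ x i) a) :
    AnalyticAt 𝕂 (jacobianDet φ) a := by
  rw [← det_analyticJacobian hφ]
  exact (analyticJacobian hφ).det.2

theorem analyticAt_jacobianAdjugate (hφ : ∀ i, AnalyticAt 𝕂 (fun x => φ x i) a) (i j : Fin n) :
    AnalyticAt 𝕂 (jacobianAdjugate φ i j) a := by
  rw [← adjugate_analyticJacobian hφ]
  exact ((analyticJacobian hφ).adjugate i j).2

/-- As `taylorHom` is a ring homomorphism, determinant and adjugate of the formal Jacobian are the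
Taylor series of the analytic ones. -/
theorem formalJacobian_taylorIncrement (hφ : ∀ i, AnalyticAt 𝕂 (fun x => φ x i) a) :
    formalJacobian (taylorIncrement φ a) = (taylorHom a).mapMatrix (analyticJacobian hφ) := by
  ext1 i j
  rw [formalJacobian, Matrix.of_apply, taylorIncrement, map_sub, MvPowerSeries.pderiv_C, sub_zero,
    pderiv_taylorSeries (hφ i)]
  rfl

theorem det_formalJacobian (hφ : ∀ i, AnalyticAt 𝕂 (fun x => φ x i) a) :
    (formalJacobian (taylorIncrement φ a)).det = taylorSeries (jacobianDet φ) a := by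
  rw [formalJacobian_taylorIncrement hφ, ← RingHom.map_det, ← det_analyticJacobian hφ]
  rfl

theorem adjugate_formalJacobian (hφ : ∀ i, AnalyticAt 𝕂 (fun x => φ x i) a) (i j : Fin n) :
    (formalJacobian (taylorIncrement φ a)).adjugate i j =
      taylorSeries (jacobianAdjugate φ i j) a := by
  rw [formalJacobian_taylorIncrement hφ, ← RingHom.map_adjugate, ← adjugate_analyticJacobian hφ]
  rfl

theorem constantCoeff_taylorIncrement (i : Fin n) :
    MvPowerSeries.constantCoeff (taylorIncrement φ a i) = 0 := by
  simp [taylorIncrement, constantCoeff_taylorSeries]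

theorem isAlgebraic_taylorSeries_jacobianDet (hφ : ∀ i, AnalyticAt 𝕂 (fun x => φ x i) 0)
    (h : ∀ i, IsAlgebraic (MvPolynomial (Fin n) 𝕂) (taylorSeries (fun x => φ x i) 0)) :
    IsAlgebraic (MvPolynomial (Fin n) 𝕂) (taylorSeries (jacobianDet φ) 0) := by
  rw [← det_formalJacobian hφ, Matrix.det_apply]
  refine Subalgebra.sum_mem (Subalgebra.algebraicClosure _ _) fun σ _ => ?_
  rw [Units.smul_def]
  refine Subalgebra.zsmul_mem _ (Subalgebra.prod_mem _ fun i _ => ?_) _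
  rw [formalJacobian_taylorIncrement hφ]
  exact isAlgebraic_taylorSeries_pderiv (hφ _) (h _) i

end Jacobian

/-! ### The local lower bound, uniform in the centre -/

section LocalEstimate

variable {𝕂 : Type*} [RCLike 𝕂] {n : ℕ}
  {φ : EuclideanSpace 𝕂 (Fin n) → EuclideanSpace 𝕂 (Fin n)}

/-- The lower bound for the radius of convergence, at the points near `0` where `α` is the initial
exponent of the Jacobian determinant. -/
theorem exists_forall_le_convergenceRadius (hφ : ∀ i, AnalyticAt 𝕂 (fun x => φ x i) 0)
    (α : Fin n →₀ ℕ) :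
    ∃ δ : ℝ, 0 < δ ∧ ∀ᶠ a in 𝓝 (0 : EuclideanSpace 𝕂 (Fin n)),
      (∀ γ, toDegLex γ < toDegLex α → multiDeriv γ (jacobianDet φ) a = 0) →
      ∀ (G : MvPowerSeries (Fin n) 𝕂) (r : ℝ), 0 < r → r ≤ 1 →
        ConvergesOnBall (formalComp G φ a) r →
        ENNReal.ofReal (δ * ‖multiDeriv α (jacobianDet φ) a‖ ^ 2 * r ^ (2 * α.degree + 1)) ≤
          convergenceRadius G := by
  let F : Option ((Fin n × Fin n) ⊕ Fin n) → EuclideanSpace 𝕂 (Fin n) → 𝕂 := fun o =>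
    o.elim (jacobianDet φ)
      (Sum.elim (fun p => jacobianAdjugate φ p.1 p.2) fun j => pderiv j (jacobianDet φ))
  have hF : ∀ o, AnalyticAt 𝕂 (F o) 0 := by
    rintro (_ | p | j)
    · exact analyticAt_jacobianDet hφ
    · exact analyticAt_jacobianAdjugate hφ p.1 p.2
    · exact analyticAt_pderiv (analyticAt_jacobianDet hφ) j
  obtain ⟨C, s₀, hs₀, hC⟩ := exists_forall_wnorm_taylorSeries_le hF
  -- With `s = r * s₁`, the first bound keeps `2 * s` below `s₀`; the second gives `√n * (2 * s) <
  -- r`, so that `G ∘ φ` has finite norm at `2 * s`.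
  set s₁ : ℝ≥0 := min (s₀ / 2) (1 / (2 * (n + 1))) with hs₁
  have hs₁0 : 0 < s₁ := lt_min (half_pos hs₀) (by positivity)
  set K : ℝ≥0 := 9 * n ^ 2 * C ^ 2 with hK
  set A : ℝ≥0 := ((∏ i, (α i).factorial : ℕ) : ℝ≥0) with hA
  have hA0 : 0 < A := by
    rw [hA]
    exact_mod_cast Finset.prod_pos fun k _ => Nat.factorial_pos _
  set d := 2 * α.degree + 1 with hd
  -- `A = α!` turns the derivative into a Taylor coefficient, and `K + 1` in place of `K` makes the
  -- final inequality strict.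
  refine ⟨(s₁ ^ d / (A ^ 2 * (K + 1)) : ℝ≥0), by positivity, ?_⟩
  filter_upwards [hC, eventually_all.2 fun i => (hφ i).eventually_analyticAt] with a ha hφa
  intro hvan G r hr hr1 hG
  by_cases hD : multiDeriv α (jacobianDet φ) a = 0
  · simp [hD]
  lift r to ℝ≥0 using hr.le
  have hr' : 0 < r := by exact_mod_cast hr
  have hr1' : r ≤ 1 := by exact_mod_cast hr1
  set s : ℝ≥0 := r * s₁ with hs
  have hs_le : s ≤ s₁ := mul_le_of_le_one_left (by simp) hr1'
  have h2s : 2 * s ≤ s₀ := by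
    calc 2 * s ≤ 2 * (s₀ / 2) := by gcongr; exact hs_le.trans (min_le_left _ _)
      _ = s₀ := mul_div_cancel₀ _ two_ne_zero
  have h2s' : (2 * s : ℝ≥0∞) ≤ s₀ := by exact_mod_cast h2s
  have hsn : 2 * s * (n + 1) ≤ r := by
    calc 2 * s * (n + 1) = r * (s₁ * (2 * (n + 1))) := by rw [hs]; ring
      _ ≤ r * (1 / (2 * (n + 1)) * (2 * (n + 1))) := by gcongr; exact min_le_right _ _
      _ = r := by field_simp
  have hs1 : s ≤ 1 := by
    refine le_trans ?_ (hsn.trans hr1')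
    calc s = s * 1 := (mul_one s).symm
      _ ≤ s * (2 * (n + 1)) := by
        gcongr
        exact le_trans (by norm_num) (mul_le_mul_right (le_add_of_nonneg_left (by simp)) 2)
      _ = _ := by ring
  have hdet := det_formalJacobian hφa
  have hx : ((s₁ ^ d / (A ^ 2 * (K + 1)) : ℝ≥0) : ℝ) *
      ‖multiDeriv α (jacobianDet φ) a‖ ^ 2 * (r : ℝ) ^ d =
      ((s₁ ^ d / (A ^ 2 * (K + 1)) * ‖multiDeriv α (jacobianDet φ) a‖₊ ^ 2 * r ^ d : ℝ≥0) : ℝ) := by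
    push_cast
    rfl
  rw [hx, ENNReal.ofReal_coe_nnreal]
  refine le_convergenceRadius (hasSubst_taylorIncrement φ a)
    (fun i => constantCoeff_taylorIncrement i) (C := C) hs1 ?_ (fun i j => ?_) (fun j => ?_)
    (α := α) ?_ ?_ ?_
  · rw [hdet]
    exact (wnorm_mono h2s' _).trans (ha none)
  · rw [adjugate_formalJacobian hφa]
    exact (wnorm_mono h2s' _).trans (ha (some (Sum.inl (i, j))))
  · rw [hdet, pderiv_taylorSeries (analyticAt_jacobianDet hφa)]
    exact (wnorm_mono h2s' _).trans (ha (some (Sum.inr j)))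
  · intro γ hγ
    rw [hdet, coeff_taylorSeries, hvan γ hγ, zero_div]
  · have h := wnorm_lt_top_of_convergesOnBall hG (t := 2 * s) ?_
    · exact_mod_cast h
    · have h1 : Real.sqrt n < n + 1 := by
        rw [Real.sqrt_lt' (by positivity)]
        nlinarith [Nat.cast_nonneg (α := ℝ) n]
      have h2 : (2 * s * (n + 1) : ℝ) ≤ r := by exact_mod_cast hsn
      have h3 : (0 : ℝ) < s := by
        rw [hs]
        positivity
      push_cast
      nlinarith
  · rw [hdet, coeff_taylorSeries, nnnorm_div, RCLike.nnnorm_natCast, ← hA]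
    have hD' : 0 < ‖multiDeriv α (jacobianDet φ) a‖₊ := nnnorm_pos.2 hD
    set N := ‖multiDeriv α (jacobianDet φ) a‖₊
    have h1 : s₁ ^ d / (A ^ 2 * (K + 1)) * N ^ 2 * r ^ d * K =
        (N / A) ^ 2 * s ^ d * (K / (K + 1)) := by
      rw [hs, mul_pow, div_pow]
      field_simp
    rw [← hK, h1]
    refine mul_lt_of_lt_one_right (by positivity) ((div_lt_one (by positivity)).2 (lt_add_one _))

end LocalEstimate

/-! ### The filtration by initial exponents -/

section Filtration

/-- Predecessors in the graded order have no larger degree. A purely lexicographic order would lack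
this finiteness. -/
theorem finite_setOf_toDegLex_le {n : ℕ} (α : Fin n →₀ ℕ) :
    {γ : DegLex (Fin n →₀ ℕ) | γ ≤ toDegLex α}.Finite := by
  refine (Finsupp.finite_of_degree_le (σ := Fin n) α.degree).subset fun γ hγ => ?_
  exact Finsupp.DegLex.monotone_degree hγ

/-- An element of a linear order with finitely many predecessors is reached by an enumeration of
an initial segment. -/
theorem exists_enumeration_of_finite_Iic {X : Type*} [LinearOrder X] {x : X}
    (hx : (Set.Iic x).Finite) :
    ∃ (k : ℕ) (e : ℕ → X), (∃ i ≤ k, e i = x) ∧ ∀ j ≤ k, ∀ y < e j, ∃ i < j, e i = y := by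
  obtain ⟨S, hS⟩ : ∃ S : Finset X, ∀ y, y ∈ S ↔ y ≤ x := ⟨hx.toFinset, by simp⟩
  have hxS : x ∈ S := (hS x).2 le_rfl
  obtain ⟨k, hk⟩ := Nat.exists_eq_succ_of_ne_zero (Finset.card_pos.2 ⟨x, hxS⟩).ne'
  have hsurj : ∀ y ∈ S, ∃ i, S.orderEmbOfFin hk i = y := by
    intro y hy
    have h := Finset.range_orderEmbOfFin S hk
    rw [Set.ext_iff] at h
    exact (h y).2 hy
  refine ⟨k, fun j => if h : j < k + 1 then S.orderEmbOfFin hk ⟨j, h⟩ else x, ?_, ?_⟩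
  · obtain ⟨i, hi⟩ := hsurj x hxS
    exact ⟨i, Nat.lt_succ_iff.1 i.2, by simp [hi]⟩
  · intro j hj y hy
    have hj' : j < k + 1 := Nat.lt_succ_iff.2 hj
    simp only [hj', dite_true] at hy
    have hyS : y ∈ S :=
      (hS y).2 (hy.le.trans ((hS _).1 (Finset.orderEmbOfFin_mem S hk ⟨j, hj'⟩)))
    obtain ⟨i, rfl⟩ := hsurj y hyS
    have hij : i < ⟨j, hj'⟩ := (S.orderEmbOfFin hk).lt_iff_lt.1 hy
    exact ⟨i, hij, dif_pos i.2⟩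

variable {𝕂 : Type*} [RCLike 𝕂] {n : ℕ}
  {φ : EuclideanSpace 𝕂 (Fin n) → EuclideanSpace 𝕂 (Fin n)}

theorem FunctionClass.IsOn.analyticOnNhd {c : FunctionClass} {U : Set (EuclideanSpace 𝕂 (Fin n))}
    {f : EuclideanSpace 𝕂 (Fin n) → 𝕂} (h : c.IsOn U f) : AnalyticOnNhd 𝕂 f U := by
  cases c with
  | algebraic => exact h.1
  | analytic => exact h

theorem isOn_multiDeriv_jacobianDet {c : FunctionClass} {V : Set (EuclideanSpace 𝕂 (Fin n))}
    (hV : V ∈ 𝓝 0) (hφ : ∀ i, c.IsOn V fun x => φ x i) {ε : ℝ} (hε : 0 < ε)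
    (hεV : Metric.ball 0 ε ⊆ V) (α : Fin n →₀ ℕ) :
    c.IsOn (Metric.ball 0 ε) (multiDeriv α (jacobianDet φ)) := by
  have hφa : ∀ a ∈ V, ∀ i, AnalyticAt 𝕂 (fun x => φ x i) a :=
    fun a ha i => (hφ i).analyticOnNhd a ha
  have hana : AnalyticOnNhd 𝕂 (multiDeriv α (jacobianDet φ)) (Metric.ball 0 ε) :=
    fun a ha => analyticAt_multiDeriv (analyticAt_jacobianDet (hφa a (hεV ha))) α
  have h0 := hφa 0 (mem_of_mem_nhds hV)
  cases c with
  | analytic => exact hana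
  | algebraic =>
    refine isNashOn_of_isAlgebraic Metric.isPreconnected_ball (Metric.mem_ball_self hε) hana ?_
    exact isAlgebraic_taylorSeries_multiDeriv (analyticAt_jacobianDet h0)
      (isAlgebraic_taylorSeries_jacobianDet h0 fun i => (hφ i).isAlgebraic_taylorSeries hV) α

theorem exists_multiDeriv_ne_zero {f : EuclideanSpace 𝕂 (Fin n) → 𝕂}
    {a : EuclideanSpace 𝕂 (Fin n)} (hf : AnalyticAt 𝕂 f a) (h : ¬ ∀ᶠ x in 𝓝 a, f x = 0) :
    ∃ α, multiDeriv α f a ≠ 0 := by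
  by_contra! h0
  refine h (eventuallyEq_zero_of_taylorSeries_eq_zero hf ?_)
  ext α
  rw [coeff_taylorSeries, h0, zero_div, map_zero]

end Filtration

end RadiusControl

open RadiusControl in
theorem theorem1p4 {𝕂 : Type*} [RCLike 𝕂] (n : ℕ) (c : RadiusControl.FunctionClass)
    (V : Set (EuclideanSpace 𝕂 (Fin n))) (hV : IsOpen V) (h0 : 0 ∈ V)
    (φ : EuclideanSpace 𝕂 (Fin n) → EuclideanSpace 𝕂 (Fin n))
    (hφ : ∀ i, c.IsOn V (fun x => φ x i))
    (hΔ : ¬ ∀ᶠ x in 𝓝 (0 : EuclideanSpace 𝕂 (Fin n)), RadiusControl.jacobianDet φ x = 0) :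
    ∃ (ε δ : ℝ) (lam k : ℕ) (X : ℕ → Set (EuclideanSpace 𝕂 (Fin n))),
      0 < ε ∧ 0 < δ ∧
      Metric.ball 0 ε ⊆ V ∧
      X 0 = Metric.ball 0 ε ∧ X (k + 1) = ∅ ∧
      (∀ j ≤ k, X (j + 1) ⊆ X j) ∧
      (∀ j ≤ k + 1, c.IsClosedSubset (Metric.ball 0 ε) (X j)) ∧
      ∀ j ≤ k, ∃ α : Fin n →₀ ℕ, ∀ a ∈ X j \ X (j + 1),
        RadiusControl.multiDeriv α (RadiusControl.jacobianDet φ) a ≠ 0 ∧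
        ∀ (G : MvPowerSeries (Fin n) 𝕂) (r : ℝ), 0 < r → r ≤ 1 →
          RadiusControl.ConvergesOnBall (RadiusControl.formalComp G φ a) r →
          ENNReal.ofReal
              (δ * ‖RadiusControl.multiDeriv α (RadiusControl.jacobianDet φ) a‖ ^ 2 * r ^ lam)
            ≤ RadiusControl.convergenceRadius G := by
  have hφ0 : ∀ i, AnalyticAt 𝕂 (fun x => φ x i) 0 := fun i => (hφ i).analyticOnNhd 0 h0
  obtain ⟨β, hβ⟩ := exists_multiDeriv_ne_zero (analyticAt_jacobianDet hφ0) hΔ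
  obtain ⟨k, e, ⟨i₀, hi₀, hei₀⟩, he⟩ :=
    exists_enumeration_of_finite_Iic (finite_setOf_toDegLex_le β)
  choose δ hδ hδe using exists_forall_le_convergenceRadius hφ0
  -- Finitely many exponents occur, so one `δ` serves all of them: the least.
  obtain ⟨j₀, hj₀⟩ := Finite.exists_min fun j : Fin (k + 1) => δ (ofDegLex (e j))
  have hne : ∀ᶠ a in 𝓝 (0 : EuclideanSpace 𝕂 (Fin n)), multiDeriv β (jacobianDet φ) a ≠ 0 :=
    (analyticAt_multiDeriv (analyticAt_jacobianDet hφ0) β).continuousAt.eventually_ne hβ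
  obtain ⟨ε, hε, hball⟩ := Metric.eventually_nhds_iff_ball.1
    ((hV.eventually_mem h0).and (hne.and
      (eventually_all.2 fun j : Fin (k + 1) => hδe (ofDegLex (e j)))))
  have hεV : Metric.ball 0 ε ⊆ V := fun a ha => (hball a ha).1
  refine ⟨ε, δ (ofDegLex (e j₀)),
    2 * (Finset.range (k + 1)).sup (fun j => (ofDegLex (e j)).degree) + 1, k,
    fun j => {x ∈ Metric.ball 0 ε | ∀ i : Fin j, multiDeriv (ofDegLex (e i)) (jacobianDet φ) x = 0},
    hε, hδ _, hεV, ?_, ?_, ?_, ?_, ?_⟩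
  · ext x
    simp
  -- The exponent `β` is among those enumerated, and `D^β Δ` has no zero in the ball.
  · refine Set.eq_empty_of_forall_notMem fun x hx => ?_
    refine (hball x hx.1).2.1 ?_
    have := hx.2 ⟨i₀, Nat.lt_succ_iff.2 hi₀⟩
    rwa [hei₀] at this
  · exact fun j _ x hx => ⟨hx.1, fun i => hx.2 i.castSucc⟩
  · exact fun j _ => ⟨j, _, fun i =>
      isOn_multiDeriv_jacobianDet (hV.mem_nhds h0) hφ hε hεV (ofDegLex (e i)), rfl⟩
  · intro j hj
    refine ⟨ofDegLex (e j), fun a ⟨ha, ha'⟩ => ⟨fun h => ha' ⟨ha.1, fun i => ?_⟩, ?_⟩⟩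
    · rcases Nat.lt_succ_iff_lt_or_eq.1 i.2 with hi | hi
      · exact ha.2 ⟨i, hi⟩
      · rwa [hi]
    intro G r hr hr1 hG
    have hj' : j < k + 1 := Nat.lt_succ_iff.2 hj
    refine le_trans (ENNReal.ofReal_le_ofReal ?_)
      ((hball a ha.1).2.2 ⟨j, hj'⟩ (fun γ hγ => ?_) G r hr hr1 hG)
    · refine mul_le_mul (by gcongr; exact hj₀ ⟨j, hj'⟩) ?_ (by positivity)
        (mul_nonneg (hδ _).le (by positivity))
      -- As `r ≤ 1`, the largest of the exponents `2|α| + 1` gives the weakest bound.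
      refine pow_le_pow_of_le_one hr.le hr1 ?_
      have := Finset.le_sup (f := fun j => (ofDegLex (e j)).degree) (Finset.mem_range.2 hj')
      simp only at this ⊢
      omega
    -- All predecessors of `e j` are enumerated before it, so `a ∈ X_j` makes their derivatives
    -- vanish.
    · obtain ⟨i, hij, hi⟩ := he j hj (toDegLex γ) hγ
      have := ha.2 ⟨i, hij⟩
      rwa [hi] at this
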